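/- **Conventions.** A *sketch* is a finite directed graph together with a set of commutativity conditions (pairs of parallel paths, written $f_n\cdots f_1=g_m\cdots g_1$) and a set of convergence conditions. A convergence condition is a finite limit condition $(C,(c_H)_{H})=\lim(\mathcal H,D)$ or a finite colimit condition $(C,(c_H)_{H})=\operatorname{colim}(\mathcal H,D)$, where $D$ is a graph morphism from a finite graph $\mathcal H$ to the given graph, $C$ is a vertex and $c_H\colon C\to D(H)$ (respectively $c_H\colon D(H)\to C$) is an arrow for each vertex $H$ of $\mathcal H$; such data are identified up to isomorphism of the indexing graph $\mathcal H$. A *morphism of sketches* is a graph morphism carrying commutativity conditions to commutativity conditions and convergence conditions to convergence conditions; it is a *subsketch inclusion* if its graph morphism is the inclusion of a subgraph. For a sketch $\mathcal Z$ and a category $\mathbb C$, a *$\mathcal Z$-structure* in $\mathbb C$ is a graph morphism $\mathcal Z\to\mathbb C$ carrying each commutativity condition to a commutative diagram and each limit/colimit condition to an actual limit/colimit in $\mathbb C$. With natural transformations these form a category $\mathcal Z\mathbb C$, and each sketch morphism $\varphi\colon\mathcal V\to\mathcal Z$ induces a functor $\varphi_{\mathbb C}\colon\mathcal Z\mathbb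 C\to\mathcal V\mathbb C$, $G\mapsto G\circ\varphi$. Write $\mathcal Z^{\varphi}_{F}\mathbb C$ for the (strict) fibre of $\varphi_{\mathbb C}$ at $F\in\mathcal V\mathbb C$. An *exactness sequent* $\alpha\vdash\beta$ of type $\mathcal X$ is a pair of subsketch inclusions $\mathcal X\xrightarrow{\alpha}\mathcal A\xrightarrow{\beta}\mathcal B$. A *functorial verification* of $\alpha\vdash\beta$ for an $\mathcal X$-structure $F$ in $\mathbb C$ is a functor $R\colon\mathcal A^{\alpha}_{F}\mathbb C\to\mathcal B^{\beta\alpha}_{F}\mathbb C$ such that $\beta^{\alpha}_{F}\circ R$ is the identity functor, where $\beta^{\alpha}_{F}\colon\mathcal B^{\beta\alpha}_{F}\mathbb C\to\mathcal A^{\alpha}_{F}\mathbb C$ is the restriction of $\beta_{\mathbb C}$. The *underlying sketch* of a finite category has the underlying graph of that category, the commutativity conditions $g\,f=(g\circ f)$ (the path $f,g$ equals the one-arrow path $g\circ f$) for all composable arrows $f,g$, and $1_A=()_A$ (the one-arrow path $1_A$ equals the empty path at $A$) for all objects $A$, and no convergence conditions. A subsketch inclusion $\alpha\colon\mathcal X\to\mathcal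 A$ is *unconditional of finite kind* if $\mathcal A$ is the underlying sketch of a finite category further equipped with the commutativity and convergence conditions which already appear in $\mathcal X$, and no others. For a small finitely cocomplete category $\mathbb C$, let $\mathrm{Lex}(\mathbb C^{\mathrm{op}},\mathbf{Set})$ be the category of finite limit preserving functors $\mathbb C^{\mathrm{op}}\to\mathbf{Set}$ and natural transformations, and let $\mathsf y'\colon\mathbb C\to\mathrm{Lex}(\mathbb C^{\mathrm{op}},\mathbf{Set})$, $C\mapsto\hom_{\mathbb C}(-,C)$, be the restricted Yoneda embedding. It preserves limits and finite colimits, so that $\mathsf y'F=\mathsf y'\circ F$ is an $\mathcal X$-structure for each $\mathcal X$-structure $F$ in $\mathbb C$. **Theorem.** Let $\mathcal X\xrightarrow{\alpha}\mathcal A\xrightarrow{\beta}\mathcal B$ be an exactness sequent such that $\alpha$ is unconditional of finite kind, let $\mathbb C$ be a small finitely cocomplete category, and let $F$ be an $\mathcal X$-structure in $\mathbb C$. If there is a functorial verification of $\alpha\vdash\beta$ for $F$, then there is also a functorial verification of $\alpha\vdash\beta$ for $\mathsf y'F$ in $\mathrm{Lex}(\mathbb C^{\mathrm{op}},\mathbf{Set})$.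 -/

import Mathlib

open CategoryTheory CategoryTheory.Limits Opposite

universe w v u v₁ u₁

namespace Exactness

/-! ### Commutativity and convergence conditions in a graph -/

/-- A commutativity condition in a graph: a pair of parallel paths. -/
structure CommCond (V : Type w) [Quiver.{w} V] : Type w where
  src : V
  tgt : V
  lhs : Quiver.Path src tgt
  rhs : Quiver.Path src tgt

/-- The image of a commutativity condition under a graph morphism. -/
def CommCond.map {V W : Type w} [Quiver.{w} V] [Quiver.{w} W] (φ : V ⥤q W)
    (c : CommCond V) : CommCond W :=
  ⟨φ.obj c.src, φ.obj c.tgt, φ.mapPath c.lhs, φ.mapPath c.rhs⟩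

/-- An isomorphism of graphs. -/
structure GraphIso (H H' : Type) [Quiver.{0} H] [Quiver.{0} H'] where
  hom : H ⥤q H'
  inv : H' ⥤q H
  hom_inv : hom ⋙q inv = 𝟭q H
  inv_hom : inv ⋙q hom = 𝟭q H'

/-- A representative `(H, D, C, (c_h))` of a finite limit condition in a graph `V`: a finite
graph `H`, a graph morphism `D : H ⥤q V`, an object `C` and arrows `c_h : C ⟶ D h`. -/
structure LimData (V : Type w) [Quiver.{w} V] where
  H : Type
  [quiver : Quiver.{0} H]
  [finite_obj : Finite H]
  [finite_hom : ∀ a b : H, Finite (a ⟶ b)]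
  D : H ⥤q V
  pt : V
  leg : ∀ h : H, pt ⟶ D.obj h

/-- A representative `(H, D, C, (c_h))` of a finite colimit condition in a graph `V`: a finite
graph `H`, a graph morphism `D : H ⥤q V`, an object `C` and arrows `c_h : D h ⟶ C`. -/
structure ColimData (V : Type w) [Quiver.{w} V] where
  H : Type
  [quiver : Quiver.{0} H]
  [finite_obj : Finite H]
  [finite_hom : ∀ a b : H, Finite (a ⟶ b)]
  D : H ⥤q V
  pt : V
  leg : ∀ h : H, D.obj h ⟶ pt

attribute [instance] LimData.quiver LimData.finite_obj LimData.finite_hom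
  ColimData.quiver ColimData.finite_obj ColimData.finite_hom

/-- Two representatives define the same finite limit condition if and only if one is the
reindexing of the other along an isomorphism of graphs. -/
def LimData.reindex {V : Type w} [Quiver.{w} V] (t : LimData V) {H' : Type} [Quiver.{0} H']
    [Finite H'] [∀ a b : H', Finite (a ⟶ b)] (I : GraphIso H' t.H) : LimData V where
  H := H'
  D := I.hom ⋙q t.D
  pt := t.pt
  leg h := t.leg (I.hom.obj h)

/-- Two representatives define the same finite colimit condition if and only if one is the
reindexing of the other along an isomorphism of graphs. -/
def ColimData.reindex {V : Type w} [Quiver.{w} V] (t : ColimData V) {H' : Type} [Quiver.{0} H']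
    [Finite H'] [∀ a b : H', Finite (a ⟶ b)] (I : GraphIso H' t.H) : ColimData V where
  H := H'
  D := I.hom ⋙q t.D
  pt := t.pt
  leg h := t.leg (I.hom.obj h)

/-- The image of a finite limit condition under a graph morphism. -/
def LimData.map {V W : Type w} [Quiver.{w} V] [Quiver.{w} W] (φ : V ⥤q W)
    (t : LimData V) : LimData W where
  H := t.H
  D := t.D ⋙q φ
  pt := φ.obj t.pt
  leg h := φ.map (t.leg h)

/-- The image of a finite colimit condition under a graph morphism. -/
def ColimData.map {V W : Type w} [Quiver.{w} V] [Quiver.{w} W] (φ : V ⥤q W)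
    (t : ColimData V) : ColimData W where
  H := t.H
  D := t.D ⋙q φ
  pt := φ.obj t.pt
  leg h := φ.map (t.leg h)

/-! ### Sketches -/

/-- An exactness sketch: a finite graph with a set of commutativity conditions and a set of
convergence conditions. A set of (equivalence classes of) convergence conditions is given by
the set of all its representatives, so that it is closed under reindexing. -/
structure Sketch where
  V : Type w
  [quiver : Quiver.{w} V]
  [finite_obj : Finite V]
  [finite_hom : ∀ a b : V, Finite (a ⟶ b)]
  comm : Set (CommCond V)
  lim : Set (LimData V)
  colim : Set (ColimData V)
  lim_reindex : ∀ t ∈ lim, ∀ {H' : Type} [Quiver.{0} H'] [Finite H']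
    [∀ a b : H', Finite (a ⟶ b)] (I : GraphIso H' t.H), t.reindex I ∈ lim
  colim_reindex : ∀ t ∈ colim, ∀ {H' : Type} [Quiver.{0} H'] [Finite H']
    [∀ a b : H', Finite (a ⟶ b)] (I : GraphIso H' t.H), t.reindex I ∈ colim

attribute [instance] Sketch.quiver Sketch.finite_obj Sketch.finite_hom

/-- A morphism of sketches: a graph morphism that carries conditions to conditions. -/
structure Sketch.Hom (X Y : Sketch.{w}) where
  graph : X.V ⥤q Y.V
  comm : ∀ c ∈ X.comm, c.map graph ∈ Y.comm
  lim : ∀ t ∈ X.lim, t.map graph ∈ Y.lim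
  colim : ∀ t ∈ X.colim, t.map graph ∈ Y.colim

/-- Composition of sketch morphisms. -/
def Sketch.Hom.comp {X Y Z : Sketch.{w}} (φ : X.Hom Y) (ψ : Y.Hom Z) : X.Hom Z where
  graph := φ.graph ⋙q ψ.graph
  comm c hc := by
    have h := ψ.comm _ (φ.comm c hc)
    simp only [CommCond.map, Prefunctor.mapPath_comp_apply] at h ⊢
    exact h
  lim t ht := ψ.lim _ (φ.lim t ht)
  colim t ht := ψ.colim _ (φ.colim t ht)

/-- A subsketch inclusion: a sketch morphism which is, as a graph morphism, the inclusion of a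
subgraph (that is, injective on objects and on arrows). -/
structure Sketch.Hom.IsSubsketchInclusion {X Y : Sketch.{w}} (φ : X.Hom Y) : Prop where
  obj_injective : Function.Injective φ.graph.obj
  map_injective : ∀ a b : X.V,
    Function.Injective (fun f : a ⟶ b => (φ.graph.map f : φ.graph.obj a ⟶ φ.graph.obj b))

/-! ### Structures of the type of a sketch in a category -/

section

variable {C : Type u} [Category.{v} C]

/-- `(pt, leg)` is a limit of the diagram `D` of shape the graph `H` in the category `C`. -/
def IsGraphLimit {H : Type} [Quiver.{0} H] (D : H ⥤q C) (pt : C)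
    (leg : ∀ h, pt ⟶ D.obj h) : Prop :=
  (∀ (a b : H) (e : a ⟶ b), leg a ≫ D.map e = leg b) ∧
    ∀ (T : C) (x : ∀ h, T ⟶ D.obj h), (∀ (a b : H) (e : a ⟶ b), x a ≫ D.map e = x b) →
      ∃! f : T ⟶ pt, ∀ h, f ≫ leg h = x h

/-- `(pt, leg)` is a colimit of the diagram `D` of shape the graph `H` in the category `C`. -/
def IsGraphColimit {H : Type} [Quiver.{0} H] (D : H ⥤q C) (pt : C)
    (leg : ∀ h, D.obj h ⟶ pt) : Prop :=
  (∀ (a b : H) (e : a ⟶ b), D.map e ≫ leg b = leg a) ∧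
    ∀ (T : C) (x : ∀ h, D.obj h ⟶ T), (∀ (a b : H) (e : a ⟶ b), D.map e ≫ x b = x a) →
      ∃! f : pt ⟶ T, ∀ h, leg h ≫ f = x h

end

/-- An exactness structure of type `Z` in a category `C`: a graph morphism that carries the
commutativity conditions to commutative diagrams and the convergence conditions to actual limits
and colimits. -/
structure Str (Z : Sketch.{w}) (C : Type u) [Category.{v} C] where
  graph : Z.V ⥤q C
  comm : ∀ c ∈ Z.comm, composePath (graph.mapPath c.lhs) = composePath (graph.mapPath c.rhs)
  lim : ∀ t ∈ Z.lim, IsGraphLimit (t.D ⋙q graph) (graph.obj t.pt) fun h => graph.map (t.leg h)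
  colim : ∀ t ∈ Z.colim,
    IsGraphColimit (t.D ⋙q graph) (graph.obj t.pt) fun h => graph.map (t.leg h)

/-- A natural transformation between two structures of the same type. -/
@[ext]
structure Str.Hom {Z : Sketch.{w}} {C : Type u} [Category.{v} C] (F G : Str Z C) where
  app : ∀ z : Z.V, F.graph.obj z ⟶ G.graph.obj z
  naturality : ∀ (a b : Z.V) (f : a ⟶ b), F.graph.map f ≫ app b = app a ≫ G.graph.map f

/-- The category of structures of type `Z` in `C`. -/
instance Str.category (Z : Sketch.{w}) (C : Type u) [Category.{v} C] : Category (Str Z C) where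
  Hom F G := Str.Hom F G
  id F := ⟨fun z => 𝟙 _, fun a b f => by simp⟩
  comp m n := ⟨fun z => m.app z ≫ n.app z, fun a b f => by
    rw [← Category.assoc, m.naturality, Category.assoc, n.naturality, Category.assoc]⟩
  id_comp m := Str.Hom.ext (funext fun z => Category.id_comp _)
  comp_id m := Str.Hom.ext (funext fun z => Category.comp_id _)
  assoc m n p := Str.Hom.ext (funext fun z => Category.assoc _ _ _)

/-- The functor of composition with a morphism of sketches. -/
def restr {X Y : Sketch.{w}} (φ : X.Hom Y) (C : Type u) [Category.{v} C] :
    Str Y C ⥤ Str X C where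
  obj F :=
    { graph := φ.graph ⋙q F.graph
      comm := fun c hc => by
        have h := F.comm _ (φ.comm c hc)
        simp only [CommCond.map] at h
        rw [Prefunctor.mapPath_comp_apply, Prefunctor.mapPath_comp_apply]
        exact h
      lim := fun t ht => F.lim _ (φ.lim t ht)
      colim := fun t ht => F.colim _ (φ.colim t ht) }
  map m := ⟨fun z => m.app (φ.graph.obj z), fun a b f => m.naturality _ _ (φ.graph.map f)⟩
  map_id _ := rfl
  map_comp _ _ := rfl

/-! ### Exactness sequents and functorial verifications -/

/-- An exactness sequent of type `X`: subsketch inclusions `α : X ⟶ A` and `β : A ⟶ B`. -/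
structure Sequent (X : Sketch.{w}) where
  A : Sketch.{w}
  B : Sketch.{w}
  α : X.Hom A
  β : A.Hom B
  α_incl : α.IsSubsketchInclusion
  β_incl : β.IsSubsketchInclusion

/-- The fibre, over `F`, of composition with `φ` (objects are the structures `G` with
`G ∘ φ = F`, morphisms are those which restrict to the identity of `F`). -/
abbrev Fib {X Y : Sketch.{w}} (φ : X.Hom Y) {C : Type u} [Category.{v} C] (F : Str X C) :=
  (restr φ C).Fiber F

/-- The restriction of the functor of composition with `β` to the fibres over `F`. -/
def Sequent.fibRestr {X : Sketch.{w}} (S : Sequent X) {C : Type u} [Category.{v} C]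
    (F : Str X C) : Fib (S.α.comp S.β) F ⥤ Fib S.α F :=
  Functor.Fiber.inducedFunctor
    (F := (Functor.Fiber.fiberInclusion : Fib (S.α.comp S.β) F ⥤ Str S.B C) ⋙ restr S.β C)
    (Functor.Fiber.fiberInclusion_comp_eq_const (p := restr (S.α.comp S.β) C) (S := F))

/-- There is a functorial verification of the sequent `S` for the structure `F`. -/
def Sequent.HasFunctorialVerification {X : Sketch.{w}} (S : Sequent X) {C : Type u}
    [Category.{v} C] (F : Str X C) : Prop :=
  ∃ R : Fib S.α F ⥤ Fib (S.α.comp S.β) F, R ⋙ S.fibRestr F = 𝟭 (Fib S.α F)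

/-! ### Unconditionality -/

/-- The structure of a category on a given graph. -/
structure CategoryOn (V : Type w) [Quiver.{w} V] where
  id : ∀ a : V, a ⟶ a
  comp : ∀ {a b c : V}, (a ⟶ b) → (b ⟶ c) → (a ⟶ c)
  id_comp : ∀ {a b : V} (f : a ⟶ b), comp (id a) f = f
  comp_id : ∀ {a b : V} (f : a ⟶ b), comp f (id b) = f
  assoc : ∀ {a b c d : V} (f : a ⟶ b) (g : b ⟶ c) (h : c ⟶ d),
    comp (comp f g) h = comp f (comp g h)

/-- The commutativity conditions of the underlying sketch of a category. -/
inductive CategoryOn.UnderlyingComm {V : Type w} [Quiver.{w} V] (K : CategoryOn V) :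
    CommCond V → Prop
  | comp {a b c : V} (f : a ⟶ b) (g : b ⟶ c) :
      K.UnderlyingComm ⟨a, c, (Quiver.Path.nil.cons f).cons g, Quiver.Path.nil.cons (K.comp f g)⟩
  | id (a : V) : K.UnderlyingComm ⟨a, a, Quiver.Path.nil.cons (K.id a), Quiver.Path.nil⟩

/-- `α : X ⟶ A` is unconditional of finite kind: `A` is the underlying sketch of a finite
category, further equipped with exactly the conditions which already appear in `X`. -/
def Sketch.Hom.IsUnconditionalOfFiniteKind {X A : Sketch.{w}} (α : X.Hom A) : Prop :=
  α.IsSubsketchInclusion ∧ ∃ K : CategoryOn A.V,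
    A.comm = {c | K.UnderlyingComm c} ∪ CommCond.map α.graph '' X.comm ∧
    A.lim = LimData.map α.graph '' X.lim ∧
    A.colim = ColimData.map α.graph '' X.colim

/-! ### The restricted Yoneda embedding -/

/-- The image of a structure under a functor which preserves limits and colimits of finite
graph diagrams. -/
def Str.mapFunctor {Z : Sketch.{w}} {C : Type u} [Category.{v} C] {D : Type u₁} [Category.{v₁} D]
    (y : C ⥤ D)
    (hl : ∀ {H : Type} [Quiver.{0} H] [Finite H] [∀ a b : H, Finite (a ⟶ b)] (K : H ⥤q C) (pt : C)
      (leg : ∀ h, pt ⟶ K.obj h), IsGraphLimit K pt leg →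
      IsGraphLimit (K ⋙q y.toPrefunctor) (y.obj pt) fun h => y.map (leg h))
    (hc : ∀ {H : Type} [Quiver.{0} H] [Finite H] [∀ a b : H, Finite (a ⟶ b)] (K : H ⥤q C) (pt : C)
      (leg : ∀ h, K.obj h ⟶ pt), IsGraphColimit K pt leg →
      IsGraphColimit (K ⋙q y.toPrefunctor) (y.obj pt) fun h => y.map (leg h))
    (F : Str Z C) : Str Z D where
  graph := F.graph ⋙q y.toPrefunctor
  comm c hc := by
    have key : ∀ {a b : Z.V} (p : Quiver.Path a b),
        composePath ((F.graph ⋙q y.toPrefunctor).mapPath p) =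
          y.map (composePath (F.graph.mapPath p)) := by
      intro a b p
      induction p with
      | nil => exact (y.map_id _).symm
      | cons p e ih =>
        rw [Prefunctor.mapPath_cons, Prefunctor.mapPath_cons, composePath_cons, composePath_cons,
          y.map_comp, ih]
        rfl
    rw [key, key, F.comm c hc]
  lim t ht := hl _ _ _ (F.lim t ht)
  colim t ht := hc _ _ _ (F.colim t ht)

section Yoneda

variable (C : Type u) [SmallCategory C]

/-- The restricted covariant Yoneda embedding `c ↦ hom(-, c)` into the category of finite limit
preserving functors `Cᵒᵖ ⥤ Type`. -/
def lexYoneda : C ⥤ (Cᵒᵖ ⥤ₗ Type u) :=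
  ObjectProperty.lift _ yoneda fun X => by
    rw [leftExactFunctor_iff]; infer_instance

variable {C}

theorem lexYoneda_isGraphLimit {H : Type} [Quiver.{0} H] (K : H ⥤q C) (pt : C)
    (leg : ∀ h, pt ⟶ K.obj h) (hK : IsGraphLimit K pt leg) :
    IsGraphLimit (K ⋙q (lexYoneda C).toPrefunctor) ((lexYoneda C).obj pt)
      fun h => (lexYoneda C).map (leg h) := by
  refine ⟨fun a b e => ?_, fun T x hx => ?_⟩
  · exact ((lexYoneda C).map_comp _ _).symm.trans (congrArg _ (hK.1 a b e))
  · let P : Cᵒᵖ ⥤ Type u := T.obj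
    let x' : ∀ h, P ⟶ yoneda.obj (K.obj h) := fun h => (x h).hom
    have hx' : ∀ (a b : H) (e : a ⟶ b), x' a ≫ yoneda.map (K.map e) = x' b :=
      fun a b e => congrArg (fun m => m.hom) (hx a b e)
    have key : ∀ (c : Cᵒᵖ) (p : P.obj c), ∃! f : c.unop ⟶ pt,
        ∀ h, f ≫ leg h = (x' h).app c p := fun c p =>
      hK.2 c.unop (fun h => (x' h).app c p) fun a b e =>
        ConcreteCategory.congr_hom (NatTrans.congr_app (hx' a b e) c) p
    choose l hl hu using key
    let m : P ⟶ yoneda.obj pt :=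
      { app := fun c => TypeCat.ofHom (l c)
        naturality := fun c d g => by
          ext p
          refine (hu d (P.map g p) _ fun h => ?_).symm
          have h1 : l c p ≫ leg h = (x' h).app c p := hl c p h
          have h2 : (x' h).app d (P.map g p) = g.unop ≫ (x' h).app c p :=
            ConcreteCategory.congr_hom ((x' h).naturality g) p
          have h3 : (g.unop ≫ l c p) ≫ leg h = (x' h).app d (P.map g p) := by
            rw [Category.assoc, h1, h2]
          exact h3 }
    refine ⟨⟨m⟩, fun h => ?_, fun n hn => ?_⟩
    · apply ObjectProperty.hom_ext
      ext c p
      exact hl _ p h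
    · apply ObjectProperty.hom_ext
      ext c p
      refine hu _ p _ fun h => ?_
      exact ConcreteCategory.congr_hom (NatTrans.congr_app (congrArg (fun m => m.hom) (hn h)) c) p

/-- A finite limit preserving functor carries colimits of finite graph diagrams to limits. -/
theorem existsUnique_of_isGraphColimit (P : Cᵒᵖ ⥤ Type u) [PreservesFiniteLimits P]
    {H : Type} [Quiver.{0} H] [Finite H] [∀ a b : H, Finite (a ⟶ b)] (K : H ⥤q C) (pt : C)
    (leg : ∀ h, K.obj h ⟶ pt) (hK : IsGraphColimit K pt leg)
    (x : ∀ h, P.obj (op (K.obj h)))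
    (hx : ∀ (a b : H) (e : a ⟶ b), P.map (K.map e).op (x b) = x a) :
    ∃! p : P.obj (op pt), ∀ h, P.map (leg h).op p = x h := by
  classical
  let J : MulticospanShape.{0, 0} :=
    { L := H, R := Σ a b : H, (a ⟶ b), fst := fun e => e.2.1, snd := fun e => e.1 }
  have : Fintype J.L := Fintype.ofFinite H
  have : Fintype J.R := Fintype.ofFinite (Σ a b : H, (a ⟶ b))
  have : DecidableEq J.L := Classical.decEq _
  have : DecidableEq J.R := Classical.decEq _
  let I : MulticospanIndex J Cᵒᵖ :=
    { left := fun h => op (K.obj h)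
      right := fun e => op (K.obj e.1)
      fst := fun e => (K.map e.2.2).op
      snd := fun e => 𝟙 _ }
  let M : Multifork I := Multifork.ofι I (op pt) (fun h => (leg h).op) fun e => by
    rw [Category.comp_id]
    exact congrArg Quiver.Hom.op (hK.1 e.1 e.2.1 e.2.2)
  have hE : ∀ (E : Multifork I) (a b : H) (e : a ⟶ b),
      K.map e ≫ (E.ι b).unop = (E.ι a).unop := fun E a b e => by
    have h := E.condition ⟨a, b, e⟩
    exact congrArg Quiver.Hom.unop (h.trans (Category.comp_id _))
  have hM : IsLimit M := Multifork.IsLimit.mk M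
    (fun E => (hK.2 E.pt.unop (fun h => (E.ι h).unop) (hE E)).choose.op)
    (fun E h => congrArg Quiver.Hom.op
      ((hK.2 E.pt.unop (fun h => (E.ι h).unop) (hE E)).choose_spec.1 h))
    (fun E m hm => congrArg Quiver.Hom.op
      ((hK.2 E.pt.unop (fun h => (E.ι h).unop) (hE E)).choose_spec.2 m.unop
        fun h => congrArg Quiver.Hom.unop (hm h)))
  have hP := (Types.isLimit_iff (P.mapCone M)).1 ⟨isLimitOfPreserves P hM⟩
  let s : ∀ j : WalkingMulticospan J, (I.multicospan ⋙ P).obj j := fun j =>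
    match j with
    | .left h => x h
    | .right e => x e.1
  have hs : s ∈ (I.multicospan ⋙ P).sections := by
    rintro (a | a) (b | b) (_ | _ | _)
    · exact ConcreteCategory.congr_hom (P.map_id (op (K.obj a))) (x a)
    · exact hx _ _ b.2.2
    · exact ConcreteCategory.congr_hom (P.map_id (op (K.obj b.1))) (x b.1)
    · exact ConcreteCategory.congr_hom (P.map_id (op (K.obj a.1))) (x a.1)
  obtain ⟨p, hp, hp'⟩ := hP s hs
  refine ⟨p, fun h => hp (.left h), fun q hq => hp' q ?_⟩
  rintro (h | e)
  · exact hq h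
  · have h1 : (M.π.app (.right e) : op pt ⟶ op (K.obj e.1)) = (leg e.1).op :=
      congrArg Quiver.Hom.op (hK.1 e.1 e.2.1 e.2.2)
    exact (ConcreteCategory.congr_hom (congrArg P.map h1) q).trans (hq e.1)

theorem lexYoneda_isGraphColimit {H : Type} [Quiver.{0} H] [Finite H]
    [∀ a b : H, Finite (a ⟶ b)] (K : H ⥤q C) (pt : C)
    (leg : ∀ h, K.obj h ⟶ pt) (hK : IsGraphColimit K pt leg) :
    IsGraphColimit (K ⋙q (lexYoneda C).toPrefunctor) ((lexYoneda C).obj pt)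
      fun h => (lexYoneda C).map (leg h) := by
  refine ⟨fun a b e => ?_, fun T x hx => ?_⟩
  · exact ((lexYoneda C).map_comp _ _).symm.trans (congrArg _ (hK.1 a b e))
  · let P : Cᵒᵖ ⥤ Type u := T.obj
    have : PreservesFiniteLimits P := T.property
    let x' : ∀ h, yoneda.obj (K.obj h) ⟶ P := fun h => (x h).hom
    have hx' : ∀ (a b : H) (e : a ⟶ b), yoneda.map (K.map e) ≫ x' b = x' a :=
      fun a b e => congrArg (fun m => m.hom) (hx a b e)
    obtain ⟨p, hp, hp'⟩ := existsUnique_of_isGraphColimit P K pt leg hK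
      (fun h => yonedaEquiv (x' h)) fun a b e => by
        rw [yonedaEquiv_naturality, hx']
    refine ⟨⟨yonedaEquiv.symm p⟩, fun h => ?_, fun n hn => ?_⟩
    · apply ObjectProperty.hom_ext
      apply yonedaEquiv.injective
      refine Eq.trans ?_ (hp h)
      exact (yonedaEquiv_naturality (yonedaEquiv.symm p) (leg h)).symm.trans
        (by rw [Equiv.apply_symm_apply])
    · apply ObjectProperty.hom_ext
      apply yonedaEquiv.injective
      refine (hp' (yonedaEquiv n.hom) fun h => ?_).trans (Equiv.apply_symm_apply _ _).symm
      exact (yonedaEquiv_naturality (F := P) n.hom (leg h)).trans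
        (congrArg (fun m => yonedaEquiv m.hom) (hn h))

/-- The structure `y' ∘ F`, for the restricted Yoneda embedding `y'`. -/
def Str.lexYoneda {Z : Sketch.{w}} (F : Str Z C) : Str Z (Cᵒᵖ ⥤ₗ Type u) :=
  F.mapFunctor (Exactness.lexYoneda C)
    (fun K pt leg h => lexYoneda_isGraphLimit K pt leg h)
    (fun K pt leg h => lexYoneda_isGraphColimit K pt leg h)

end Yoneda

end Exactness

-- Write y for the restricted Yoneda embedding. Each structure G in the fibre of α over y∘F is,
-- vertex by vertex, a filtered colimit of structures y∘H, with H in the fibre over F in C, indexed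
-- by the comma category of `fibLexYoneda` over G. A verification R for F turns every such H
-- functorially into a B-structure, so the vertexwise colimit of the y∘R(H), a left Kan extension
-- (`lanStr`), is the candidate for the verification at G. It is a B-structure because filtered
-- colimits of left exact functors are computed pointwise: finite limit conditions survive since
-- finite limits commute with filtered colimits of sets, and colimit conditions survive since
-- colimits commute with colimits. Its restriction to A is the colimit of the y∘H, hence isomorphic
-- to G. As β is injective on vertices, restriction along β is an isofibration, and the isomorphism
-- can be replaced by an equality.
--
-- Unconditionality of α enters in the density statement. Let K be the finite category underlying A.
-- Diagrams L : K → C with a map y∘L → G form a filtered category, because composition with y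
-- preserves finite colimits. The comma category of the fibre is a full subcategory of it, and every
-- (L, m) maps into this subcategory: a finite Kan extension along a mapping cylinder
-- (`exists_hom_of_mem_essImage`) replaces L by a diagram that agrees with G, hence with F, at the
-- vertices of X. Since A has no conditions besides those of K and of X, this diagram is an
-- A-structure. So the comma category of the fibre is filtered, and free diagrams on an object at a
-- vertex (`exists_free_diagram`) show that its colimit at that vertex is that of G.

universe u₂ v₂ u₃ v₃

namespace Exactness

/-! ### Structures, transport along isomorphisms, and isofibrations -/

section Basic

variable {X Y Z : Sketch.{w}} {D : Type u} [Category.{v} D]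

/-- Evaluation of structures at a vertex of the sketch. -/
@[simps]
def Str.ev (Z : Sketch.{w}) (D : Type u) [Category.{v} D] (z : Z.V) : Str Z D ⥤ D where
  obj F := F.graph.obj z
  map m := m.app z

@[ext]
theorem Str.hom_ext {F G : Str Z D} {m n : F ⟶ G} (h : ∀ z, m.app z = n.app z) : m = n :=
  Str.Hom.ext (funext h)

@[simp]
theorem Str.id_app (F : Str Z D) (z : Z.V) : Str.Hom.app (𝟙 F) z = 𝟙 (F.graph.obj z) := rfl

@[simp]
theorem Str.comp_app {F G H : Str Z D} (m : F ⟶ G) (n : G ⟶ H) (z : Z.V) :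
    Str.Hom.app (m ≫ n) z = m.app z ≫ n.app z := rfl

/-- Components of isomorphisms of structures. -/
@[simps]
def Str.isoApp {F G : Str Z D} (e : F ≅ G) (z : Z.V) : F.graph.obj z ≅ G.graph.obj z where
  hom := e.hom.app z
  inv := e.inv.app z
  hom_inv_id := by rw [← Str.comp_app, e.hom_inv_id, Str.id_app]
  inv_hom_id := by rw [← Str.comp_app, e.inv_hom_id, Str.id_app]

/-- An isomorphism of structures from its components. -/
@[simps]
def Str.isoMk {F G : Str Z D} (e : ∀ z, F.graph.obj z ≅ G.graph.obj z)
    (h : ∀ (a b : Z.V) (f : a ⟶ b), F.graph.map f ≫ (e b).hom = (e a).hom ≫ G.graph.map f) :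
    F ≅ G where
  hom := ⟨fun z => (e z).hom, h⟩
  inv := ⟨fun z => (e z).inv, fun a b f => by
    rw [Iso.eq_inv_comp, ← Category.assoc, ← h, Category.assoc, Iso.hom_inv_id,
      Category.comp_id]⟩
  hom_inv_id := by ext z; exact (e z).hom_inv_id
  inv_hom_id := by ext z; exact (e z).inv_hom_id

theorem mapPath_naturality {V : Type w} [Quiver.{w} V] {P Q : V ⥤q D}
    (e : ∀ z, P.obj z ⟶ Q.obj z)
    (h : ∀ (a b : V) (f : a ⟶ b), P.map f ≫ e b = e a ≫ Q.map f)
    {a b : V} (p : Quiver.Path a b) :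
    composePath (P.mapPath p) ≫ e b = e a ≫ composePath (Q.mapPath p) := by
  induction p with
  | nil => exact (Category.id_comp _).trans (Category.comp_id _).symm
  | cons p f ih =>
    rw [Prefunctor.mapPath_cons, Prefunctor.mapPath_cons, composePath_cons, composePath_cons,
      Category.assoc, h, ← Category.assoc, ih, Category.assoc]

theorem IsGraphLimit.of_iso {H : Type} [Quiver.{0} H] {K K' : H ⥤q D} {pt pt' : D}
    {leg : ∀ h, pt ⟶ K.obj h} {leg' : ∀ h, pt' ⟶ K'.obj h} (e : ∀ h, K.obj h ≅ K'.obj h)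
    (i : pt ≅ pt') (he : ∀ (a b : H) (f : a ⟶ b), K.map f ≫ (e b).hom = (e a).hom ≫ K'.map f)
    (hi : ∀ h, leg h ≫ (e h).hom = i.hom ≫ leg' h) (hK : IsGraphLimit K pt leg) :
    IsGraphLimit K' pt' leg' := by
  have hl : ∀ h, leg' h = i.inv ≫ leg h ≫ (e h).hom := fun h => by simp [hi]
  have he' : ∀ (a b : H) (f : a ⟶ b), K'.map f = (e a).inv ≫ K.map f ≫ (e b).hom :=
    fun a b f => by simp [he]
  refine ⟨fun a b f => ?_, fun T x hx => ?_⟩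
  · simp [hl, he', ← hK.1 a b f]
  · obtain ⟨f, hf, hf'⟩ := hK.2 T (fun h => x h ≫ (e h).inv) fun a b f => by
      simp [← hx a b f, he']
    refine ⟨f ≫ i.hom, fun h => ?_, fun g hg => ?_⟩
    · simp [hl, reassoc_of% (hf h)]
    · rw [← Iso.comp_inv_eq]
      exact hf' _ fun h => by simp [← hg h, hl]

theorem IsGraphColimit.of_iso {H : Type} [Quiver.{0} H] {K K' : H ⥤q D} {pt pt' : D}
    {leg : ∀ h, K.obj h ⟶ pt} {leg' : ∀ h, K'.obj h ⟶ pt'} (e : ∀ h, K.obj h ≅ K'.obj h)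
    (i : pt ≅ pt') (he : ∀ (a b : H) (f : a ⟶ b), K.map f ≫ (e b).hom = (e a).hom ≫ K'.map f)
    (hi : ∀ h, leg h ≫ i.hom = (e h).hom ≫ leg' h) (hK : IsGraphColimit K pt leg) :
    IsGraphColimit K' pt' leg' := by
  have hl : ∀ h, leg' h = (e h).inv ≫ leg h ≫ i.hom := fun h => by simp [hi]
  have he' : ∀ (a b : H) (f : a ⟶ b), K'.map f = (e a).inv ≫ K.map f ≫ (e b).hom :=
    fun a b f => by simp [he]
  refine ⟨fun a b f => ?_, fun T x hx => ?_⟩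
  · simp [hl, he', ← hK.1 a b f]
  · obtain ⟨f, hf, hf'⟩ := hK.2 T (fun h => (e h).hom ≫ x h) fun a b f => by
      simp [← hx a b f, he']
    refine ⟨i.inv ≫ f, fun h => ?_, fun g hg => ?_⟩
    · simp [hl, hf h]
    · rw [Iso.eq_inv_comp]
      exact hf' _ fun h => by simp [← hg h, hl]

/-- A graph morphism isomorphic to a structure is a structure. -/
@[simps graph]
def Str.ofGraphIso (F : Str Z D) (P : Z.V ⥤q D) (e : ∀ z, F.graph.obj z ≅ P.obj z)
    (h : ∀ (a b : Z.V) (f : a ⟶ b), F.graph.map f ≫ (e b).hom = (e a).hom ≫ P.map f) :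
    Str Z D where
  graph := P
  comm c hc := by
    have h1 := mapPath_naturality (fun z => (e z).hom) h c.lhs
    have h2 := mapPath_naturality (fun z => (e z).hom) h c.rhs
    rw [F.comm c hc, h2] at h1
    exact ((cancel_epi _).1 h1).symm
  lim t ht := IsGraphLimit.of_iso (fun h => e (t.D.obj h)) (e t.pt) (fun _ _ f => h _ _ (t.D.map f))
    (fun i => h _ _ (t.leg i)) (F.lim t ht)
  colim t ht := IsGraphColimit.of_iso (fun h => e (t.D.obj h)) (e t.pt)
    (fun _ _ f => h _ _ (t.D.map f)) (fun i => h _ _ (t.leg i)) (F.colim t ht)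

/-- Naturality with identity components forces the two graph morphisms to agree on arrows, and the
remaining fields are propositions. The fibres are strict, so such equalities are needed. -/
theorem Str.exists_eq_eqToHom {F G : Str Z D} (m : F ⟶ G)
    (h : ∀ z, ∃ hz : F.graph.obj z = G.graph.obj z, m.app z = eqToHom hz) :
    ∃ hFG : F = G, m = eqToHom hFG := by
  obtain ⟨⟨Fo, Fm⟩, _, _, _⟩ := F
  obtain ⟨⟨Go, Gm⟩, _, _, _⟩ := G
  choose ho hm using h
  obtain rfl : Fo = Go := funext ho
  have hm' : ∀ z, m.app z = 𝟙 (Fo z) := hm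
  have : @Fm = @Gm := by
    funext a b f
    have := m.naturality a b f
    rw [hm', hm'] at this
    exact (Category.comp_id _).symm.trans (this.trans (Category.id_comp _))
  subst this
  refine ⟨rfl, ?_⟩
  ext z
  exact hm' z

/-- Isomorphisms in the target of a functor lift, strictly, along the functor. -/
def IsIsofibration {E : Type*} {B : Type*} [Category* E] [Category* B] (p : E ⥤ B) : Prop :=
  ∀ (x : E) (b : B) (e : p.obj x ≅ b), ∃ (x' : E) (h : p.obj x' = b) (e' : x ≅ x'),
    p.map e'.hom = e.hom ≫ eqToHom h.symm

/-- Put the prescribed objects at the vertices in the image of `φ`, keep the old ones elsewhere, and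
conjugate all arrows. Injectivity makes the prescription unambiguous. -/
theorem isIsofibration_restr (φ : X.Hom Y) (hφ : Function.Injective φ.graph.obj) :
    IsIsofibration (restr φ D) := by
  intro H F e
  have key : ∀ a : Y.V, ∃ (o : D) (i : H.graph.obj a ≅ o), ∀ (x : X.V) (hx : φ.graph.obj x = a),
      ∃ h : F.graph.obj x = o,
        e.hom.app x = eqToHom (congrArg H.graph.obj hx) ≫ i.hom ≫ eqToHom h.symm := by
    intro a
    by_cases ha : ∃ x, φ.graph.obj x = a
    · obtain ⟨x, rfl⟩ := ha
      refine ⟨_, Str.isoApp e x, fun x' hx => ?_⟩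
      obtain rfl := hφ hx
      exact ⟨rfl, ((Category.id_comp _).trans (Category.comp_id _)).symm⟩
    · exact ⟨_, Iso.refl _, fun x hx => (ha ⟨x, hx⟩).elim⟩
  choose o i hF hi using key
  let P : Y.V ⥤q D :=
    { obj := o
      map := fun {a b} f => (i a).inv ≫ H.graph.map f ≫ (i b).hom }
  have hP : ∀ (a b : Y.V) (f : a ⟶ b),
      H.graph.map f ≫ (i b).hom = (i a).hom ≫ P.map f := fun a b f => by simp [P]
  let H' : Str Y D := H.ofGraphIso P i hP
  let e' : H ≅ H' := Str.isoMk i hP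
  obtain ⟨h, hh⟩ := Str.exists_eq_eqToHom ((restr φ D).map e'.inv ≫ e.hom) fun x => by
    refine ⟨(hF _ x rfl).symm, ?_⟩
    have := hi _ x rfl
    simp only [eqToHom_refl, Category.id_comp] at this
    rw [Str.comp_app, this]
    exact (i (φ.graph.obj x)).inv_hom_id_assoc _
  refine ⟨H', h, e', ?_⟩
  rw [← cancel_mono (eqToHom h), Category.assoc, eqToHom_trans, eqToHom_refl, Category.comp_id,
    ← hh, ← Functor.map_comp_assoc, Iso.hom_inv_id, CategoryTheory.Functor.map_id, Category.id_comp]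

/-- Lift each component of `e` separately and conjugate the arrows of `R` by the lifts; conjugation
makes the result functorial whatever lifts are chosen. -/
theorem IsIsofibration.exists_functor {E B J : Type*} [Category* E] [Category* B] [Category* J]
    {p : E ⥤ B} (hp : IsIsofibration p) (R : J ⥤ E) (Q : J ⥤ B) (e : R ⋙ p ≅ Q) :
    ∃ R' : J ⥤ E, R' ⋙ p = Q := by
  choose o ho i hi using fun j => hp (R.obj j) (Q.obj j) (e.app j)
  have hi' : ∀ j, p.map (i j).inv = eqToHom (ho j) ≫ e.inv.app j := fun j => by
    rw [← cancel_epi (p.map (i j).hom), ← p.map_comp, Iso.hom_inv_id, p.map_id, hi]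
    simp
  refine ⟨{ obj := o, map := fun {j k} f => (i j).inv ≫ R.map f ≫ (i k).hom }, ?_⟩
  refine CategoryTheory.Functor.ext ho fun j k f => ?_
  have := e.hom.naturality f
  dsimp at this ⊢
  simp [hi, hi', reassoc_of% this]

end Basic

/-! ### Full faithfulness of the restricted Yoneda embedding -/

section LexYoneda

variable (Z : Sketch.{w}) (C : Type u) [SmallCategory C]

/-- Composition of structures with the restricted Yoneda embedding. -/
@[simps]
def strLexYoneda : Str Z C ⥤ Str Z (Cᵒᵖ ⥤ₗ Type u) where
  obj F := F.lexYoneda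
  map m := ⟨fun z => (lexYoneda C).map (m.app z), fun a b f =>
    ((lexYoneda C).map_comp _ _).symm.trans
      ((congrArg _ (m.naturality a b f)).trans ((lexYoneda C).map_comp _ _))⟩
  map_id _ := Str.hom_ext fun _ => (lexYoneda C).map_id _
  map_comp _ _ := Str.hom_ext fun _ => (lexYoneda C).map_comp _ _

/-- The restricted Yoneda embedding is fully faithful. -/
def lexYonedaFullyFaithful : (lexYoneda C).FullyFaithful where
  preimage f := Yoneda.fullyFaithful.preimage f.hom
  map_preimage f := ObjectProperty.hom_ext _ (Yoneda.fullyFaithful.map_preimage f.hom)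
  preimage_map f := Yoneda.fullyFaithful.preimage_map f

instance : (lexYoneda C).Full := (lexYonedaFullyFaithful C).full
instance : (lexYoneda C).Faithful := (lexYonedaFullyFaithful C).faithful

instance : (strLexYoneda Z C).Faithful where
  map_injective {F G m n} h := by
    ext z
    exact (lexYoneda C).map_injective (congrArg (fun k => Str.Hom.app k z) h)

end LexYoneda

end Exactness

namespace Exactness

/-! ### Filtered colimits of left exact functors -/

section LexColimits

variable (C : Type u) [SmallCategory C] [HasFiniteColimits C]
variable (J : Type u₁) [Category.{v₁} J] [EssentiallySmall.{u} J] [IsFiltered J]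

/-- Over a finitely cocomplete category the left exact presheaves are exactly the ind-objects, and
these are closed under small filtered colimits. -/
instance isClosedUnderColimitsOfShape_leftExactFunctor :
    (leftExactFunctor Cᵒᵖ (Type u)).IsClosedUnderColimitsOfShape J := by
  have e := equivSmallModel.{u} J
  have : IsFiltered (SmallModel.{u} J) := IsFiltered.of_equivalence e
  suffices (leftExactFunctor Cᵒᵖ (Type u)).IsClosedUnderColimitsOfShape (SmallModel.{u} J) from
    .of_equivalence e.symm
  refine .mk' ?_
  rintro _ ⟨F, hF⟩
  rw [leftExactFunctor_iff, ← isIndObject_iff_preservesFiniteLimits]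
  exact isIndObject_colimit _ F fun i =>
    (isIndObject_iff_preservesFiniteLimits _).2 (hF i)

omit [HasFiniteColimits C] [IsFiltered J] in
theorem hasColimitsOfShape_presheaf : HasColimitsOfShape J (Cᵒᵖ ⥤ Type u) :=
  hasColimitsOfShape_of_equivalence (equivSmallModel.{u} J).symm

theorem hasColimitsOfShape_lex : HasColimitsOfShape J (Cᵒᵖ ⥤ₗ Type u) := by
  have := hasColimitsOfShape_presheaf C J
  exact hasColimitsOfShape_of_closedUnderColimits _ _

/-- Evaluation of left exact functors. -/
abbrev lexEval (c : C) : (Cᵒᵖ ⥤ₗ Type u) ⥤ Type u :=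
  ObjectProperty.ι _ ⋙ (evaluation Cᵒᵖ (Type u)).obj (op c)

theorem preservesColimitsOfShape_lexEval (c : C) :
    PreservesColimitsOfShape J (lexEval C c) := by
  have := hasColimitsOfShape_presheaf C J
  have : HasColimitsOfShape J (Type u) :=
    hasColimitsOfShape_of_equivalence (equivSmallModel.{u} J).symm
  have := hasColimitsOfShape_lex C J
  infer_instance

end LexColimits

/-! ### Finite families in a filtered category -/

section FilteredFamilies

variable {J : Type u₁} [Category.{v₁} J] [IsFiltered J]

/-- The category of objects under `i` is again filtered, so finitely many of its objects have a
common upper bound. -/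
theorem exists_of_forall_exists_hom {ι : Type*} [Finite ι] (i : J) (j : ι → J)
    (u : ∀ k, i ⟶ j k) : ∃ (l : J) (a : i ⟶ l) (b : ∀ k, j k ⟶ l), ∀ k, u k ≫ b k = a := by
  classical
  have := Fintype.ofFinite ι
  obtain ⟨S, hS⟩ := IsFiltered.sup_objs_exists
    (Finset.univ.image fun k => Under.mk (u k))
  have hS' : ∀ k, Nonempty (Under.mk (u k) ⟶ S) := fun k => hS (Finset.mem_image_of_mem _ (by simp))
  exact ⟨S.right, S.hom, fun k => (hS' k).some.right, fun k => Under.w (hS' k).some⟩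

theorem exists_of_finite_family {ι : Type*} [Finite ι] (j : ι → J) :
    ∃ l : J, Nonempty (∀ k, j k ⟶ l) := by
  classical
  have := Fintype.ofFinite ι
  obtain ⟨S, hS⟩ := IsFiltered.sup_objs_exists (Finset.univ.image j)
  have hS' : ∀ k, Nonempty (j k ⟶ S) := fun k => hS (Finset.mem_image_of_mem _ (by simp))
  exact ⟨S, ⟨fun k => (hS' k).some⟩⟩

end FilteredFamilies

/-! ### Elements of left exact functors -/

section LexElements

variable {C : Type u} [SmallCategory C]

/-- A cone of left exact functors which is a limit elementwise is a limit. -/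
theorem isGraphLimit_lex {H : Type} [Quiver.{0} H] (K : H ⥤q (Cᵒᵖ ⥤ₗ Type u))
    (pt : Cᵒᵖ ⥤ₗ Type u) (leg : ∀ h, pt ⟶ K.obj h)
    (hw : ∀ (a b : H) (e : a ⟶ b), leg a ≫ K.map e = leg b)
    (hK : ∀ (c : Cᵒᵖ) (x : ∀ h, (K.obj h).obj.obj c),
      (∀ (a b : H) (e : a ⟶ b), (K.map e).hom.app c (x a) = x b) →
      ∃! p : pt.obj.obj c, ∀ h, (leg h).hom.app c p = x h) :
    IsGraphLimit K pt leg := by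
  refine ⟨hw, fun T x hx => ?_⟩
  have key : ∀ (c : Cᵒᵖ) (t : T.obj.obj c), ∃! p : pt.obj.obj c,
      ∀ h, (leg h).hom.app c p = (x h).hom.app c t := fun c t =>
    hK c (fun h => (x h).hom.app c t) fun a b e =>
      ConcreteCategory.congr_hom
        (NatTrans.congr_app (congrArg (fun m => m.hom) (hx a b e)) c) t
  choose l hl hu using key
  let m : T.obj ⟶ pt.obj :=
    { app := fun c => TypeCat.ofHom (l c)
      naturality := fun c d g => by
        ext t
        refine (hu d (T.obj.map g t) _ fun h => ?_).symm
        have h1 : (leg h).hom.app c (l c t) = (x h).hom.app c t := hl c t h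
        have h2 := ConcreteCategory.congr_hom ((leg h).hom.naturality g) (l c t)
        have h3 := ConcreteCategory.congr_hom ((x h).hom.naturality g) t
        exact h2.trans ((congrArg _ h1).trans h3.symm) }
  refine ⟨⟨m⟩, fun h => ?_, fun n hn => ?_⟩
  · apply ObjectProperty.hom_ext
    ext c t
    exact hl c t h
  · apply ObjectProperty.hom_ext
    ext c t
    refine hu c t _ fun h => ?_
    exact ConcreteCategory.congr_hom (NatTrans.congr_app (congrArg (fun m => m.hom) (hn h)) c) t

variable {J : Type u₁} [Category.{v₁} J]

/-- The element of a left exact functor `P` named by an arrow and a map from a representable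
functor to `P`. -/
def lexElem {P : Cᵒᵖ ⥤ₗ Type u} {c d : C} (m : (Exactness.lexYoneda C).obj d ⟶ P) (f : c ⟶ d) :
    P.obj.obj (op c) :=
  m.hom.app (op c) f

theorem lexElem_comp {P Q : Cᵒᵖ ⥤ₗ Type u} {c d : C} (m : (Exactness.lexYoneda C).obj d ⟶ P) (n : P ⟶ Q)
    (f : c ⟶ d) : n.hom.app (op c) (lexElem m f) = lexElem (m ≫ n) f := rfl

theorem lexElem_map_comp {P : Cᵒᵖ ⥤ₗ Type u} {c d e : C} (m : (Exactness.lexYoneda C).obj e ⟶ P)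
    (g : d ⟶ e) (f : c ⟶ d) :
    lexElem ((Exactness.lexYoneda C).map g ≫ m) f = lexElem m (f ≫ g) := rfl

theorem lexElem_injective {P : Cᵒᵖ ⥤ₗ Type u} {d : C} {m n : (Exactness.lexYoneda C).obj d ⟶ P}
    (h : lexElem m (𝟙 d) = lexElem n (𝟙 d)) : m = n := by
  apply ObjectProperty.hom_ext
  exact yonedaEquiv.injective h

variable [HasFiniteColimits C] [EssentiallySmall.{u} J] [IsFiltered J]
  {N : J ⥤ C} {s : Cocone (N ⋙ Exactness.lexYoneda C)} (hs : IsColimit s)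
include hs

theorem exists_lexElem_eq {c : C} (p : s.pt.obj.obj (op c)) :
    ∃ (j : J) (f : c ⟶ N.obj j), lexElem (s.ι.app j) f = p := by
  have := preservesColimitsOfShape_lexEval C J c
  exact Types.jointly_surjective_of_isColimit (isColimitOfPreserves (lexEval C c) hs) p

theorem lexElem_eq_iff {c : C} {j : J} (f g : c ⟶ N.obj j) :
    lexElem (s.ι.app j) f = lexElem (s.ι.app j) g ↔
      ∃ (k : J) (u : j ⟶ k), f ≫ N.map u = g ≫ N.map u := by
  have := preservesColimitsOfShape_lexEval C J c
  exact Types.FilteredColimit.isColimit_eq_iff' (isColimitOfPreserves (lexEval C c) hs) f g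

end LexElements

/-! ### Vertexwise filtered colimits of structures are structures -/

section ColimitOfStructures

variable {C : Type u} [SmallCategory C]
  {J : Type u₁} [Category.{v₁} J] {Z : Sketch.{w}}

/-- The graph morphism `P` is, vertexwise, the filtered colimit of the structures `V`. -/
structure IsVertexwiseColimit (V : J ⥤ Str Z C) (P : Z.V ⥤q (Cᵒᵖ ⥤ₗ Type u))
    (m : ∀ z j, (Exactness.lexYoneda C).obj ((V.obj j).graph.obj z) ⟶ P.obj z) : Prop where
  w : ∀ (z : Z.V) (j k : J) (u : j ⟶ k), (Exactness.lexYoneda C).map ((V.map u).app z) ≫ m z k = m z j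
  naturality : ∀ (a b : Z.V) (f : a ⟶ b) (j : J),
    (Exactness.lexYoneda C).map ((V.obj j).graph.map f) ≫ m b j = m a j ≫ P.map f
  hom_ext : ∀ (z : Z.V) {T : Cᵒᵖ ⥤ₗ Type u} {f g : P.obj z ⟶ T},
    (∀ j, m z j ≫ f = m z j ≫ g) → f = g
  exists_desc : ∀ (z : Z.V) {T : Cᵒᵖ ⥤ₗ Type u}
    (f : ∀ j, (Exactness.lexYoneda C).obj ((V.obj j).graph.obj z) ⟶ T),
    (∀ (j k : J) (u : j ⟶ k), (Exactness.lexYoneda C).map ((V.map u).app z) ≫ f k = f j) →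
      ∃ g : P.obj z ⟶ T, ∀ j, m z j ≫ g = f j
  exists_elem : ∀ (z : Z.V) {c : C} (p : (P.obj z).obj.obj (op c)),
    ∃ (j : J) (f : c ⟶ (V.obj j).graph.obj z), lexElem (m z j) f = p
  elem_eq : ∀ (z : Z.V) {c : C} {j : J} {f g : c ⟶ (V.obj j).graph.obj z},
    lexElem (m z j) f = lexElem (m z j) g →
      ∃ (k : J) (u : j ⟶ k), f ≫ (V.map u).app z = g ≫ (V.map u).app z

/-- The cocone at a vertex. -/
@[simps]
def vertexCocone {V : J ⥤ Str Z C} {P : Z.V ⥤q (Cᵒᵖ ⥤ₗ Type u)}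
    (m : ∀ z j, (Exactness.lexYoneda C).obj ((V.obj j).graph.obj z) ⟶ P.obj z)
    (w : ∀ (z : Z.V) (j k : J) (u : j ⟶ k), (Exactness.lexYoneda C).map ((V.map u).app z) ≫ m z k = m z j)
    (z : Z.V) : Cocone ((V ⋙ Str.ev Z C z) ⋙ Exactness.lexYoneda C) where
  pt := P.obj z
  ι :=
    { app := m z
      naturality := fun j k u => (w z j k u).trans (Category.comp_id _).symm }

theorem IsVertexwiseColimit.of_isColimit [HasFiniteColimits C] [EssentiallySmall.{u} J]
    [IsFiltered J] {V : J ⥤ Str Z C} {P : Z.V ⥤q (Cᵒᵖ ⥤ₗ Type u)}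
    {m : ∀ z j, (Exactness.lexYoneda C).obj ((V.obj j).graph.obj z) ⟶ P.obj z}
    (w : ∀ (z : Z.V) (j k : J) (u : j ⟶ k), (Exactness.lexYoneda C).map ((V.map u).app z) ≫ m z k = m z j)
    (h : ∀ (a b : Z.V) (f : a ⟶ b) (j : J),
      (Exactness.lexYoneda C).map ((V.obj j).graph.map f) ≫ m b j = m a j ≫ P.map f)
    (hs : ∀ z, IsColimit (vertexCocone m w z)) : IsVertexwiseColimit V P m where
  w := w
  naturality := h
  hom_ext z _ _ _ hfg := (hs z).hom_ext hfg
  exists_desc z T f hf :=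
    let t : Cocone ((V ⋙ Str.ev Z C z) ⋙ Exactness.lexYoneda C) :=
      { pt := T
        ι :=
          { app := f
            naturality := fun j k u => (hf j k u).trans (Category.comp_id _).symm } }
    ⟨(hs z).desc t, (hs z).fac t⟩
  exists_elem z _ p := exists_lexElem_eq (hs z) p
  elem_eq z _ _ _ _ hfg := (lexElem_eq_iff (hs z) _ _).1 hfg

variable {V : J ⥤ Str Z C} {P : Z.V ⥤q (Cᵒᵖ ⥤ₗ Type u)}
  {m : ∀ z j, (Exactness.lexYoneda C).obj ((V.obj j).graph.obj z) ⟶ P.obj z}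
  (H : IsVertexwiseColimit V P m)

namespace IsVertexwiseColimit
include H

theorem composePath_eq {a b : Z.V} (p q : Quiver.Path a b)
    (h : ∀ j, composePath ((V.obj j).lexYoneda.graph.mapPath p) =
      composePath ((V.obj j).lexYoneda.graph.mapPath q)) :
    composePath (P.mapPath p) = composePath (P.mapPath q) := by
  refine H.hom_ext a fun j => ?_
  have key : ∀ r : Quiver.Path a b,
      composePath ((V.obj j).lexYoneda.graph.mapPath r) ≫ m b j =
        m a j ≫ composePath (P.mapPath r) := fun r =>
    mapPath_naturality (P := (V.obj j).lexYoneda.graph) (fun z => m z j)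
      (fun a b f => H.naturality a b f j) r
  exact (key p).symm.trans ((congrArg (· ≫ m b j) (h j)).trans (key q))

/-- Colimits commute with colimits: a cocone on the diagram in `P` gives one at each stage `j`, and
the induced maps out of the stages glue to a map out of `P.obj t.pt`. -/
theorem isGraphColimit (t : ColimData Z.V)
    (h : ∀ j, IsGraphColimit (t.D ⋙q (V.obj j).lexYoneda.graph) ((V.obj j).lexYoneda.graph.obj t.pt)
      fun h => (V.obj j).lexYoneda.graph.map (t.leg h)) :
    IsGraphColimit (t.D ⋙q P) (P.obj t.pt) fun h => P.map (t.leg h) := by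
  have hc : ∀ (a b : t.H) (e : a ⟶ b), P.map (t.D.map e) ≫ P.map (t.leg b) = P.map (t.leg a) := by
    intro a b e
    refine H.hom_ext _ fun j => ?_
    have h4 : (Exactness.lexYoneda C).map ((V.obj j).graph.map (t.D.map e)) ≫
      (Exactness.lexYoneda C).map ((V.obj j).graph.map (t.leg b)) =
        (Exactness.lexYoneda C).map ((V.obj j).graph.map (t.leg a)) := (h j).1 a b e
    rw [← Category.assoc, ← H.naturality, ← H.naturality, Category.assoc, ← H.naturality,
      ← Category.assoc, h4]
  refine ⟨hc, fun T (x : ∀ h, P.obj (t.D.obj h) ⟶ T)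
    (hx : ∀ (a b : t.H) (e : a ⟶ b), P.map (t.D.map e) ≫ x b = x a) => ?_⟩
  have key : ∀ j, ∃! f : (Exactness.lexYoneda C).obj ((V.obj j).graph.obj t.pt) ⟶ T,
      ∀ h, (Exactness.lexYoneda C).map ((V.obj j).graph.map (t.leg h)) ≫ f = m (t.D.obj h) j ≫ x h :=
    fun j => (h j).2 T (fun h => m (t.D.obj h) j ≫ x h) fun a b e => by
      change (Exactness.lexYoneda C).map ((V.obj j).graph.map (t.D.map e)) ≫ m (t.D.obj b) j ≫ x b = _
      rw [← hx a b e, ← Category.assoc, H.naturality, Category.assoc]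
      rfl
  choose f hf hf' using key
  -- Compatibility with transitions follows from uniqueness of the factorization at stage `j`.
  have hf'' : ∀ (j k : J) (u : j ⟶ k), (Exactness.lexYoneda C).map ((V.map u).app t.pt) ≫ f k = f j := by
    refine fun j k u => hf' j _ fun h => ?_
    have h1 := (V.map u).naturality _ _ (t.leg h)
    rw [← Category.assoc, ← (Exactness.lexYoneda C).map_comp, h1, (Exactness.lexYoneda C).map_comp, Category.assoc,
      hf, ← Category.assoc, H.w]
  obtain ⟨g, hg⟩ := H.exists_desc _ f hf''
  refine ⟨g, fun h => H.hom_ext _ fun j => ?_, fun g' hg' => H.hom_ext _ fun j => ?_⟩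
  · change m (t.D.obj h) j ≫ P.map (t.leg h) ≫ g = _
    rw [← Category.assoc, ← H.naturality, Category.assoc, ← hf, hg]
  · rw [hg]
    refine hf' j _ fun h => ?_
    have : P.map (t.leg h) ≫ g' = x h := hg' h
    rw [← this, ← Category.assoc, ← Category.assoc, H.naturality]

theorem elem_map {a b : Z.V} (f : a ⟶ b) {j : J} {c : C} (g : c ⟶ (V.obj j).graph.obj a) :
    (P.map f).hom.app (op c) (lexElem (m a j) g) =
      lexElem (m b j) (g ≫ (V.obj j).graph.map f) := by
  rw [lexElem_comp, ← lexElem_map_comp, H.naturality]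

theorem elem_transition {a : Z.V} {j k : J} (u : j ⟶ k) {c : C}
    (g : c ⟶ (V.obj j).graph.obj a) :
    lexElem (m a k) (g ≫ (V.map u).app a) = lexElem (m a j) g := by
  rw [← lexElem_map_comp, H.w]

variable [IsFiltered J]

theorem exists_common_elem {ι : Type*} [Finite ι] (z : ι → Z.V) {c : C}
    (x : ∀ i, (P.obj (z i)).obj.obj (op c)) :
    ∃ (j : J) (f : ∀ i, c ⟶ (V.obj j).graph.obj (z i)), ∀ i, lexElem (m (z i) j) (f i) = x i := by
  choose j f hf using fun i => H.exists_elem (z i) (x i)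
  obtain ⟨l, ⟨v⟩⟩ := exists_of_finite_family j
  exact ⟨l, fun i => f i ≫ (V.map (v i)).app (z i), fun i =>
    (H.elem_transition (v i) (f i)).trans (hf i)⟩

theorem exists_common_elem_eq {ι : Type*} [Finite ι] (z : ι → Z.V) {c : C} {j : J}
    {f g : ∀ i, c ⟶ (V.obj j).graph.obj (z i)}
    (hfg : ∀ i, lexElem (m (z i) j) (f i) = lexElem (m (z i) j) (g i)) :
    ∃ (k : J) (u : j ⟶ k), ∀ i, f i ≫ (V.map u).app (z i) = g i ≫ (V.map u).app (z i) := by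
  choose k u hu using fun i => H.elem_eq (z i) (hfg i)
  obtain ⟨l, a, b, hab⟩ := exists_of_forall_exists_hom j k u
  refine ⟨l, a, fun i => ?_⟩
  rw [← hab i, V.map_comp, Str.comp_app, ← Category.assoc, hu, Category.assoc]

/-- Finite limits commute with filtered colimits of sets. By finiteness of the shape, a compatible
family is represented at one stage and its equations hold at a later one, where the limit property
applies; uniqueness is similar. -/
theorem isGraphLimit (t : LimData Z.V)
    (h : ∀ j, IsGraphLimit (t.D ⋙q (V.obj j).graph) ((V.obj j).graph.obj t.pt)
      fun h => (V.obj j).graph.map (t.leg h)) :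
    IsGraphLimit (t.D ⋙q P) (P.obj t.pt) fun h => P.map (t.leg h) := by
  have hl : ∀ (j : J) (a b : t.H) (e : a ⟶ b), (V.obj j).graph.map (t.leg a) ≫
      (V.obj j).graph.map (t.D.map e) = (V.obj j).graph.map (t.leg b) := fun j => (h j).1
  refine isGraphLimit_lex _ _ _ (fun a b e => ?_) ?_
  · refine H.hom_ext _ fun j => ?_
    change m _ j ≫ P.map _ ≫ P.map _ = m _ j ≫ _
    rw [← Category.assoc, ← H.naturality, ← H.naturality, Category.assoc, ← H.naturality,
      ← Category.assoc, ← (Exactness.lexYoneda C).map_comp, hl]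
  rintro ⟨c⟩ (x : ∀ i, (P.obj (t.D.obj i)).obj.obj (op c))
    (hx : ∀ (a b : t.H) (e : a ⟶ b), (P.map (t.D.map e)).hom.app (op c) (x a) = x b)
  refine existsUnique_of_exists_of_unique ?_ fun p p'
    (hp : ∀ i, (P.map (t.leg i)).hom.app (op c) p = x i)
    (hp' : ∀ i, (P.map (t.leg i)).hom.app (op c) p' = x i) => ?_
  · obtain ⟨j, f, hf⟩ := H.exists_common_elem t.D.obj x
    -- One equation for each arrow of the shape; there are finitely many.
    obtain ⟨k, u, hu⟩ := H.exists_common_elem_eq (ι := Σ a b : t.H, (a ⟶ b))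
      (fun e => t.D.obj e.2.1) (f := fun e => f e.1 ≫ (V.obj j).graph.map (t.D.map e.2.2))
      (g := fun e => f e.2.1) (j := j) fun e => by
        rw [← H.elem_map, hf, hf, hx]
    obtain ⟨g, hg, -⟩ := (h k).2 c (fun i => f i ≫ (V.map u).app (t.D.obj i)) fun a b e => by
      have h1 : (f a ≫ (V.obj j).graph.map (t.D.map e)) ≫ (V.map u).app (t.D.obj b) =
        f b ≫ (V.map u).app (t.D.obj b) := hu ⟨a, b, e⟩
      have h2 := (V.map u).naturality _ _ (t.D.map e)
      change (f a ≫ (V.map u).app (t.D.obj a)) ≫ (V.obj k).graph.map (t.D.map e) = _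
      rw [Category.assoc, ← h2, ← Category.assoc, h1]
      rfl
    refine ⟨lexElem (m t.pt k) g, fun i => ?_⟩
    have hgi : g ≫ (V.obj k).graph.map (t.leg i) = f i ≫ (V.map u).app (t.D.obj i) := hg i
    change (P.map (t.leg i)).hom.app (op c) _ = x i
    rw [H.elem_map, hgi, H.elem_transition, hf]
  -- The two candidates are brought to a common stage.
  · obtain ⟨j, f, hf⟩ := H.exists_common_elem (ι := Bool) (fun _ => t.pt)
      (fun b => bif b then p else p')
    have h1 : lexElem (m t.pt j) (f true) = p := hf true
    have h2 : lexElem (m t.pt j) (f false) = p' := hf false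
    obtain ⟨k, u, hu⟩ := H.exists_common_elem_eq (ι := t.H)
      t.D.obj (f := fun i => f true ≫ (V.obj j).graph.map (t.leg i))
      (g := fun i => f false ≫ (V.obj j).graph.map (t.leg i)) fun i => by
        rw [← H.elem_map, ← H.elem_map, h1, h2, hp, hp']
    rw [← h1, ← h2, ← H.elem_transition u, ← H.elem_transition u]
    congr 1
    refine ((h k).2 c (fun i => (f false ≫ (V.map u).app t.pt) ≫ (V.obj k).graph.map (t.leg i))
      fun a b e => ?_).unique (fun i => ?_) fun i => rfl
    · exact (Category.assoc _ _ _).trans (congrArg _ (hl k a b e))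
    · change (f true ≫ (V.map u).app t.pt) ≫ (V.obj k).graph.map (t.leg i) =
        (f false ≫ (V.map u).app t.pt) ≫ (V.obj k).graph.map (t.leg i)
      rw [Category.assoc, Category.assoc, ← (V.map u).naturality, ← Category.assoc,
        ← Category.assoc]
      exact hu i

end IsVertexwiseColimit

/-- A vertexwise filtered colimit of structures is a structure. -/
def Str.ofIsVertexwiseColimit [IsFiltered J] (H : IsVertexwiseColimit V P m) :
    Str Z (Cᵒᵖ ⥤ₗ Type u) where
  graph := P
  comm c hc := H.composePath_eq _ _ fun j => (V.obj j).lexYoneda.comm c hc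
  lim t ht := H.isGraphLimit t fun j => (V.obj j).lim t ht
  colim t ht := H.isGraphColimit t fun j => (V.obj j).lexYoneda.colim t ht

end ColimitOfStructures

end Exactness

namespace Exactness

/-! ### Left Kan extension of diagrams of structures -/

section KanExtension

variable {C : Type u} [SmallCategory C] [HasFiniteColimits C]
  {K : Type u₁} [Category.{v₁} K] {G : Type u₂} [Category.{v₂} G] (Y : K ⥤ G)
  [∀ g, IsFiltered (CostructuredArrow Y g)] [∀ g, EssentiallySmall.{u} (CostructuredArrow Y g)]

instance hasPointwiseLeftKanExtension_lex (N : K ⥤ (Cᵒᵖ ⥤ₗ Type u)) :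
    Y.HasPointwiseLeftKanExtension N := fun g => by
  have := hasColimitsOfShape_lex C (CostructuredArrow Y g)
  infer_instance

variable {Y}

/-- The legs of the colimit cocones of a pointwise left Kan extension. -/
noncomputable def lanLeg (N : K ⥤ (Cᵒᵖ ⥤ₗ Type u)) {g : G} (i : CostructuredArrow Y g) :
    N.obj i.left ⟶ (Y.lan.obj N).obj g :=
  (Y.lanUnit.app N).app i.left ≫ (Y.lan.obj N).map i.hom

theorem lanLeg_w (N : K ⥤ (Cᵒᵖ ⥤ₗ Type u)) {g : G} {i j : CostructuredArrow Y g} (u : i ⟶ j) :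
    N.map u.left ≫ lanLeg N j = lanLeg N i := by
  have h := (Y.lanUnit.app N).naturality u.left
  have h' : N.map u.left ≫ (Y.lanUnit.app N).app j.left =
    (Y.lanUnit.app N).app i.left ≫ (Y.lan.obj N).map (Y.map u.left) := h
  rw [lanLeg, ← Category.assoc, h', Category.assoc, ← Functor.map_comp, CostructuredArrow.w]
  rfl

theorem lanLeg_naturality {N N' : K ⥤ (Cᵒᵖ ⥤ₗ Type u)} (φ : N ⟶ N') {g : G}
    (i : CostructuredArrow Y g) :
    φ.app i.left ≫ lanLeg N' i = lanLeg N i ≫ (Y.lan.map φ).app g := by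
  have h : φ.app i.left ≫ (Y.lanUnit.app N').app i.left =
      (Y.lanUnit.app N).app i.left ≫ (Y.lan.map φ).app (Y.obj i.left) :=
    NatTrans.congr_app (Y.lanUnit.naturality φ) i.left
  rw [lanLeg, lanLeg, ← Category.assoc, h, Category.assoc, Category.assoc, NatTrans.naturality]

/-- The colimit property of the legs of a pointwise left Kan extension. -/
noncomputable def isPointwiseLan (N : K ⥤ (Cᵒᵖ ⥤ₗ Type u)) :
    (Functor.LeftExtension.mk (Y.lan.obj N) (Y.lanUnit.app N)).IsPointwiseLeftKanExtension :=
  Functor.isPointwiseLeftKanExtensionOfIsLeftKanExtension _ _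

variable {Z : Sketch.{w}} (U : K ⥤ Str Z C)

/-- The presheaf-valued diagram at a vertex. -/
abbrev vertexDiagram (z : Z.V) : K ⥤ (Cᵒᵖ ⥤ₗ Type u) :=
  (U ⋙ Str.ev Z C z) ⋙ Exactness.lexYoneda C

/-- The transformation of diagrams along an arrow of the sketch. -/
@[simps]
def vertexDiagramMap {a b : Z.V} (f : a ⟶ b) : vertexDiagram U a ⟶ vertexDiagram U b where
  app k := (Exactness.lexYoneda C).map ((U.obj k).graph.map f)
  naturality _ _ u :=
    (((Exactness.lexYoneda C).map_comp _ _).symm.trans (congrArg _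
      ((U.map u).naturality a b f).symm)).trans ((Exactness.lexYoneda C).map_comp _ _)

variable (Y)

/-- The underlying graph morphism of the Kan extension of a diagram of structures. -/
@[simps]
noncomputable def lanGraph (g : G) : Z.V ⥤q (Cᵒᵖ ⥤ₗ Type u) where
  obj z := (Y.lan.obj (vertexDiagram U z)).obj g
  map f := (Y.lan.map (vertexDiagramMap U f)).app g

/-- This makes the Kan extension structure-valued: its value at `g` is at each vertex a colimit over
the same filtered category, the comma category over `g`. -/
theorem isVertexwiseColimit_lanGraph (g : G) :
    IsVertexwiseColimit (CostructuredArrow.proj Y g ⋙ U) (lanGraph Y U g)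
      fun z i => lanLeg (vertexDiagram U z) i :=
  .of_isColimit (fun z _ _ u => lanLeg_w (vertexDiagram U z) u)
    (fun _ _ f i => lanLeg_naturality (vertexDiagramMap U f) i)
    fun z => isPointwiseLan (vertexDiagram U z) g

/-- The pointwise left Kan extension of a diagram of structures, with values in structures in the
category of left exact functors. -/
noncomputable def lanStr : G ⥤ Str Z (Cᵒᵖ ⥤ₗ Type u) where
  obj g := Str.ofIsVertexwiseColimit (isVertexwiseColimit_lanGraph Y U g)
  map f := ⟨fun z => (Y.lan.obj (vertexDiagram U z)).map f, fun _ _ e =>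
    ((Y.lan.map (vertexDiagramMap U e)).naturality f).symm⟩
  map_id g := Str.hom_ext fun z => (Y.lan.obj (vertexDiagram U z)).map_id g
  map_comp f f' := Str.hom_ext fun z => (Y.lan.obj (vertexDiagram U z)).map_comp f f'

variable {Y U}

/-- Five faces of a cube commute, hence so does the sixth after precomposition with `l`. Used with
`l` a colimit leg to compare maps out of a Kan extension. -/
theorem comp_comp_eq_of_squares {D : Type*} [Category* D] {x x' a a' c c' t t' : D}
    {p : x ⟶ x'} {l : x ⟶ a} {l' : x' ⟶ a'} {q : a ⟶ a'} {e : a ⟶ c} {e' : a' ⟶ c'}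
    {k : x ⟶ t} {k' : x' ⟶ t'} {n : t ⟶ c} {n' : t' ⟶ c'} {r : t ⟶ t'} {s : c ⟶ c'}
    (h₁ : p ≫ l' = l ≫ q) (h' : l' ≫ e' = k' ≫ n') (h : l ≫ e = k ≫ n)
    (h₂ : p ≫ k' = k ≫ r) (h₃ : r ≫ n' = n ≫ s) : l ≫ q ≫ e' = l ≫ e ≫ s := by
  rw [← Category.assoc, ← h₁, Category.assoc, h', ← Category.assoc, h₂, Category.assoc, h₃,
    ← Category.assoc, ← h, Category.assoc]

/-- The component at a vertex of a transformation of diagrams of structures. -/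
@[simps]
def vertexTransformation {Γ : G ⥤ Str Z (Cᵒᵖ ⥤ₗ Type u)} (θ : U ⋙ strLexYoneda Z C ⟶ Y ⋙ Γ)
    (z : Z.V) : vertexDiagram U z ⟶ Y ⋙ Γ ⋙ Str.ev Z _ z where
  app k := (θ.app k).app z
  naturality _ _ u := congrArg (fun m => Str.Hom.app m z) (θ.naturality u)

/-- The Kan extension of a diagram of structures is determined by its vertices. -/
noncomputable def lanStrIso {Γ : G ⥤ Str Z (Cᵒᵖ ⥤ₗ Type u)} (θ : U ⋙ strLexYoneda Z C ⟶ Y ⋙ Γ)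
    (h : ∀ z, (Functor.LeftExtension.mk (Γ ⋙ Str.ev Z _ z)
      (vertexTransformation θ z)).IsPointwiseLeftKanExtension) :
    lanStr Y U ≅ Γ :=
  have : ∀ z, (Γ ⋙ Str.ev Z _ z).IsLeftKanExtension (vertexTransformation θ z) :=
    fun z => (h z).isLeftKanExtension
  -- At each vertex both sides are left Kan extensions of the same diagram.
  let e : ∀ z, Y.lan.obj (vertexDiagram U z) ≅ Γ ⋙ Str.ev Z _ z := fun z =>
    Functor.leftKanExtensionUnique _ (Y.lanUnit.app (vertexDiagram U z)) _
      (vertexTransformation θ z)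
  have he : ∀ z g (i : CostructuredArrow Y g), lanLeg (vertexDiagram U z) i ≫ (e z).hom.app g =
      (θ.app i.left).app z ≫ (Γ.map i.hom).app z := fun z g i => by
    have h1 : (Y.lanUnit.app (vertexDiagram U z)).app i.left ≫ (e z).hom.app (Y.obj i.left) =
        (θ.app i.left).app z :=
      (Y.lan.obj (vertexDiagram U z)).descOfIsLeftKanExtension_fac_app
        (Y.lanUnit.app (vertexDiagram U z)) _ (vertexTransformation θ z) i.left
    rw [lanLeg, Category.assoc, NatTrans.naturality, ← Category.assoc, h1]
    rfl
  NatIso.ofComponents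
    (fun g => Str.isoMk (fun z => (e z).app g) fun a b f => by
      refine (isVertexwiseColimit_lanGraph Y U g).hom_ext a fun i => ?_
      have h1 := lanLeg_naturality (vertexDiagramMap U f) i
      have h2 := (θ.app i.left).naturality a b f
      have h3 := (Γ.map i.hom).naturality a b f
      exact comp_comp_eq_of_squares h1 (he b g i) (he a g i) h2 h3)
    fun f => Str.hom_ext fun z => (e z).hom.naturality f

end KanExtension

end Exactness

namespace Exactness

/-! ### The Yoneda embedding and finite colimits -/

section FiniteColimits

theorem isGraphColimit_of_isColimit {D : Type u} [Category.{v} D] {J : Type} [SmallCategory J]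
    {F : J ⥤ D} {s : Cocone F} (hs : IsColimit s) :
    IsGraphColimit F.toPrefunctor s.pt fun j => s.ι.app j := by
  refine ⟨fun _ _ e => s.w e, fun T x hx => ?_⟩
  let t : Cocone F :=
    { pt := T
      ι := { app := x, naturality := fun a b e => (hx a b e).trans (Category.comp_id _).symm } }
  exact ⟨hs.desc t, hs.fac t, fun f hf => hs.uniq t f hf⟩

/-- The converse of `isGraphColimit_of_isColimit`. -/
noncomputable def isColimitOfIsGraphColimit {D : Type u} [Category.{v} D] {J : Type}
    [SmallCategory J] {F : J ⥤ D} {s : Cocone F}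
    (hs : IsGraphColimit F.toPrefunctor s.pt fun j => s.ι.app j) : IsColimit s where
  desc t := (hs.2 t.pt t.ι.app fun _ _ e => t.w e).choose
  fac t := (hs.2 t.pt t.ι.app fun _ _ e => t.w e).choose_spec.1
  uniq t m hm := (hs.2 t.pt t.ι.app fun _ _ e => t.w e).choose_spec.2 m hm

instance preservesFiniteColimits_lexYoneda (C : Type u) [SmallCategory C] :
    PreservesFiniteColimits (lexYoneda C) where
  preservesFiniteColimits _ _ _ :=
    { preservesColimit :=
        { preserves := fun hs =>
            ⟨isColimitOfIsGraphColimit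
              (lexYoneda_isGraphColimit _ _ _ (isGraphColimit_of_isColimit hs))⟩ } }

variable {B : Type w} [SmallCategory B] [FinCategory B] {C : Type u} [SmallCategory C]
  [HasFiniteColimits C]

/-- Colimits of diagrams are pointwise, so composition with the embedding preserves finite colimits;
it is therefore coflat, which gives filtered comma categories. -/
instance isFiltered_costructuredArrow_whiskeringRight (T : B ⥤ (Cᵒᵖ ⥤ₗ Type u)) :
    IsFiltered (CostructuredArrow ((Functor.whiskeringRight B C _).obj (lexYoneda C)) T) := by
  have : PreservesFiniteColimits ((Functor.whiskeringRight B C _).obj (lexYoneda C)) :=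
    ⟨fun J _ _ => preservesColimitsOfShape_of_evaluation _ J fun b => by
      change PreservesColimitsOfShape J ((evaluation B C).obj b ⋙ lexYoneda C)
      infer_instance⟩
  have := coflat_of_preservesFiniteColimits ((Functor.whiskeringRight B C _).obj (lexYoneda C))
  infer_instance

end FiniteColimits

/-! ### Kan extensions between finite categories -/

section FiniteKanExtension

variable {B : Type w} [SmallCategory B] [FinCategory B] {E : Type w} [SmallCategory E]
  [FinCategory E] (p : E ⥤ B) {C : Type u} [SmallCategory C] [HasFiniteColimits C]

noncomputable instance finCategory_costructuredArrow (b : B) : FinCategory (CostructuredArrow p b) where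
  fintypeObj :=
    have : Finite (CostructuredArrow p b) :=
      Finite.of_injective (fun i : CostructuredArrow p b => (⟨i.left, i.hom⟩ : Σ e, p.obj e ⟶ b))
        fun i j h => by
          obtain ⟨l, ⟨⟨⟩⟩, f⟩ := i
          obtain ⟨l', ⟨⟨⟩⟩, f'⟩ := j
          cases h
          rfl
    Fintype.ofFinite _
  fintypeHom i j :=
    have : Finite (i ⟶ j) :=
      Finite.of_injective (fun f : i ⟶ j => f.left) fun f g h => CostructuredArrow.hom_ext _ _ h
    Fintype.ofFinite _

instance hasPointwiseLeftKanExtension_of_finCategory (Q : E ⥤ C) :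
    p.HasPointwiseLeftKanExtension Q := fun b => by
  have := hasColimitsOfShape_of_hasFiniteColimits C (CostructuredArrow p b)
  infer_instance

/-- The comma categories of `p` are finite, so the extension is built from finite colimits, which
the embedding preserves. -/
instance preservesLeftKanExtension_lexYoneda (Q : E ⥤ C) :
    (lexYoneda C).PreservesLeftKanExtension Q p := by
  have : ∀ b, PreservesColimitsOfShape (CostructuredArrow p b) (lexYoneda C) := fun b => by
    infer_instance
  infer_instance

end FiniteKanExtension

end Exactness

namespace Exactness

/-! ### Free diagrams and gluing along a mapping cylinder -/

section Gluing

variable {B : Type w} [SmallCategory B] [FinCategory B] {C : Type u} [SmallCategory C]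
  [HasFiniteColimits C]

/-- The free diagram on an object at a vertex. -/
theorem exists_free_diagram (b : B) (c : C) :
    ∃ (L : B ⥤ C) (η : c ⟶ L.obj b),
      (∀ (L' : B ⥤ C) (f : c ⟶ L'.obj b), ∃ l : L ⟶ L', η ≫ l.app b = f) ∧
      ∀ (T : B ⥤ (Cᵒᵖ ⥤ₗ Type u)) (x : (lexYoneda C).obj c ⟶ T.obj b),
        ∃! m : L ⋙ lexYoneda C ⟶ T, (lexYoneda C).map η ≫ m.app b = x := by
  -- The free diagram is the Kan extension along the inclusion of the vertex `b`. Its universal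
  -- property also holds against ind-diagrams because the embedding preserves this extension.
  let p : Discrete PUnit.{w + 1} ⥤ B := Functor.fromPUnit b
  let Q : Discrete PUnit.{w + 1} ⥤ C := Functor.fromPUnit c
  let L := p.leftKanExtension Q
  let η : Q ⟶ p ⋙ L := p.leftKanExtensionUnit Q
  refine ⟨L, η.app ⟨⟨⟩⟩, fun L' f => ?_, fun T x => ?_⟩
  · let β : Q ⟶ p ⋙ L' :=
      { app := fun _ => f
        naturality := by
          rintro ⟨⟨⟩⟩ ⟨⟨⟩⟩ ⟨⟨⟨⟩⟩⟩
          exact (Category.id_comp f).trans ((Category.comp_id f).symm.trans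
            (congrArg _ (L'.map_id b).symm)) }
    exact ⟨L.descOfIsLeftKanExtension η L' β, L.descOfIsLeftKanExtension_fac_app η L' β ⟨⟨⟩⟩⟩
  · let η' : Q ⋙ lexYoneda C ⟶ p ⋙ L ⋙ lexYoneda C :=
      Functor.whiskerRight η (lexYoneda C) ≫ (Functor.associator _ _ _).hom
    have : (L ⋙ lexYoneda C).IsLeftKanExtension η' := inferInstance
    have hη : η'.app ⟨⟨⟩⟩ = (lexYoneda C).map (η.app ⟨⟨⟩⟩) := Category.comp_id _
    let β : Q ⋙ lexYoneda C ⟶ p ⋙ T :=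
      { app := fun _ => x
        naturality := by
          rintro ⟨⟨⟩⟩ ⟨⟨⟩⟩ ⟨⟨⟨⟩⟩⟩
          have h1 : (lexYoneda C).map (𝟙 c) ≫ x = x := by
            rw [(lexYoneda C).map_id, Category.id_comp]
          have h2 : x ≫ T.map (𝟙 b) = x := by rw [T.map_id, Category.comp_id]
          exact h1.trans h2.symm }
    refine ⟨(L ⋙ lexYoneda C).descOfIsLeftKanExtension η' T β, ?_, fun m hm => ?_⟩
    · exact (congrArg (· ≫ _) hη.symm).trans
        ((L ⋙ lexYoneda C).descOfIsLeftKanExtension_fac_app η' T β ⟨⟨⟩⟩)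
    · refine (L ⋙ lexYoneda C).hom_ext_of_isLeftKanExtension η' _ _ ?_
      rw [Functor.descOfIsLeftKanExtension_fac]
      ext1
      ext1 ⟨⟨⟩⟩
      exact (congrArg (· ≫ _) hη).trans hm

/-- The mapping cylinder of a transformation, with the target restricted to the vertices in `S`. -/
abbrev Cylinder (S : ObjectProperty B) :=
  ObjectProperty.FullSubcategory (C := Fin 2 × B) fun x => x.1 = 1 → S x.2

noncomputable instance finCategory_cylinder (S : ObjectProperty B) : FinCategory (Cylinder S) where
  fintypeObj :=
    have : Finite (Cylinder S) :=
      Finite.of_injective (fun x => x.obj) fun _ _ h => ObjectProperty.FullSubcategory.ext h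
    Fintype.ofFinite _
  fintypeHom x y :=
    have : Finite (x.obj ⟶ y.obj) :=
      inferInstanceAs (Finite ((x.obj.1 ⟶ y.obj.1) × (x.obj.2 ⟶ y.obj.2)))
    have : Finite (x ⟶ y) :=
      Finite.of_injective (fun f : x ⟶ y => f.hom) fun _ _ h => ObjectProperty.hom_ext _ h
    Fintype.ofFinite _

/-- A diagram over an ind-diagram can be replaced by one which agrees with the ind-diagram at a
given set of vertices, at which the latter is representable. -/
theorem exists_hom_of_mem_essImage (S : ObjectProperty B) (K : B ⥤ C)
    (T : B ⥤ (Cᵒᵖ ⥤ₗ Type u)) (m : K ⋙ lexYoneda C ⟶ T)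
    (hS : ∀ b, S b → (lexYoneda C).essImage (T.obj b)) :
    ∃ (L : B ⥤ C) (k : K ⟶ L) (n : L ⋙ lexYoneda C ⟶ T),
      Functor.whiskerRight k (lexYoneda C) ≫ n = m ∧ ∀ b, S b → IsIso (n.app b) := by
  -- View `m` as an arrow over `T` from `K ⋙ lexYoneda C` to `T` itself. Uncurrying gives a diagram
  -- with `K` at the end 0 and `T` at the end 1, together with a map `μ` to `T`.
  let M : Fin 2 ⥤ Over T := ComposableArrows.mk₁
    (Over.homMk m (Category.comp_id m) : Over.mk m ⟶ Over.mk (𝟙 T))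
  let inc : Cylinder S ⥤ Fin 2 × B := ObjectProperty.ι _
  let p : Cylinder S ⥤ B := inc ⋙ CategoryTheory.Prod.snd _ _
  let Q' : Cylinder S ⥤ (Cᵒᵖ ⥤ₗ Type u) := inc ⋙ Functor.uncurry.obj (M ⋙ Over.forget T)
  -- Cutting the end 1 down to `S` leaves only representable values, so the diagram on the cylinder
  -- lifts to `C`.
  have hQ' : ∀ x, (lexYoneda C).essImage (Q'.obj x) := by
    rintro ⟨⟨i, b⟩, hb⟩
    fin_cases i
    · exact ⟨K.obj b, ⟨Iso.refl _⟩⟩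
    · exact hS b (hb rfl)
  let Q : Cylinder S ⥤ C := Functor.essImage.liftFunctor Q' (lexYoneda C) hQ'
  let ε : Q ⋙ lexYoneda C ≅ Q' := Functor.essImage.liftFunctorCompIso Q' (lexYoneda C) hQ'
  let μ : Q' ⟶ p ⋙ T :=
    { app := fun x => (M.obj x.obj.1).hom.app x.obj.2
      naturality := fun x y f => by
        have h1 := NatTrans.congr_app (Over.w (M.map f.hom.1)) x.obj.2
        have h2 := (M.obj y.obj.1).hom.naturality f.hom.2
        exact (Category.assoc _ _ _).trans ((congrArg _ h2).trans
          ((Category.assoc _ _ _).symm.trans (congrArg (· ≫ T.map f.hom.2) h1))) }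
  let L := p.leftKanExtension Q
  let η : Q ⟶ p ⋙ L := p.leftKanExtensionUnit Q
  let η' : Q ⋙ lexYoneda C ⟶ p ⋙ L ⋙ lexYoneda C :=
    Functor.whiskerRight η (lexYoneda C) ≫ (Functor.associator _ _ _).hom
  have : (L ⋙ lexYoneda C).IsLeftKanExtension η' := inferInstance
  have hη : ∀ x, η'.app x = (lexYoneda C).map (η.app x) := fun x => Category.comp_id _
  let n : L ⋙ lexYoneda C ⟶ T :=
    (L ⋙ lexYoneda C).descOfIsLeftKanExtension η' T (ε.hom ≫ μ)
  have hn : ∀ x, (lexYoneda C).map (η.app x) ≫ n.app (p.obj x) = ε.hom.app x ≫ μ.app x := fun x =>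
    (congrArg (· ≫ _) (hη x).symm).trans
      ((L ⋙ lexYoneda C).descOfIsLeftKanExtension_fac_app η' T (ε.hom ≫ μ) x)
  -- The end 0 of the cylinder; the unit restricted to it yields the map `K ⟶ L` by full
  -- faithfulness.
  let z : B → Cylinder S := fun b => ⟨(0, b), fun h => absurd h Fin.zero_ne_one⟩
  let zm : ∀ {a b : B} (f : a ⟶ b), z a ⟶ z b := fun f => ⟨(𝟙 _, f)⟩
  let κ : K ⋙ lexYoneda C ⟶ L ⋙ lexYoneda C :=
    { app := fun b => ε.inv.app (z b) ≫ (lexYoneda C).map (η.app (z b))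
      naturality := fun a b f => by
        have h1 : (lexYoneda C).map (K.map f) ≫ ε.inv.app (z b) =
            ε.inv.app (z a) ≫ (lexYoneda C).map (Q.map (zm f)) := by
          refine Eq.trans ?_ (ε.inv.naturality (zm f))
          refine congrArg (· ≫ ε.inv.app (z b)) ?_
          have h3 : (M.map (𝟙 (0 : Fin 2))).left = 𝟙 _ := by rw [M.map_id]; rfl
          have h4 : (M.map (𝟙 (0 : Fin 2))).left.app a = 𝟙 ((lexYoneda C).obj (K.obj a)) :=
            NatTrans.congr_app h3 a
          exact (Category.id_comp _).symm.trans
            (congrArg (· ≫ (lexYoneda C).map (K.map f)) h4.symm)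
        have h2 : (lexYoneda C).map (Q.map (zm f)) ≫ (lexYoneda C).map (η.app (z b)) =
            (lexYoneda C).map (η.app (z a)) ≫ (lexYoneda C).map (L.map f) := by
          rw [← (lexYoneda C).map_comp, ← (lexYoneda C).map_comp]
          exact congrArg _ (η.naturality (zm f))
        exact (Category.assoc _ _ _).symm.trans ((congrArg (· ≫ _) h1).trans
          ((Category.assoc _ _ _).trans ((congrArg _ h2).trans (Category.assoc _ _ _).symm))) }
  let hy := (lexYonedaFullyFaithful C).whiskeringRight B
  have hκ : Functor.whiskerRight (hy.preimage κ) (lexYoneda C) = κ := hy.map_preimage κ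
  refine ⟨L, hy.preimage κ, n, ?_, fun b hb => ?_⟩
  · rw [hκ]
    ext1
    ext1 b
    have h1 := hn (z b)
    have h2 : ε.inv.app (z b) ≫ ε.hom.app (z b) ≫ μ.app (z b) = μ.app (z b) := by
      rw [Iso.inv_hom_id_app_assoc]
    exact (Category.assoc _ _ _).trans ((congrArg _ h1).trans h2)
  -- For `b` in `S`, the vertex (1, b) with the identity is terminal in the comma category over `b`,
  -- so the unit there is invertible. As `μ` is the identity at (1, b), `n` is invertible at `b`.
  · let o : Cylinder S := ⟨(1, b), fun _ => hb⟩
    let t : CostructuredArrow p b := CostructuredArrow.mk (Y := o) (𝟙 b)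
    have ht : IsTerminal t := IsTerminal.ofUniqueHom
      (fun i => CostructuredArrow.homMk ⟨(homOfLE (Fin.le_last _), i.hom)⟩ (Category.comp_id _))
      fun i f => by
        apply CostructuredArrow.hom_ext
        apply ObjectProperty.hom_ext
        refine Prod.ext (Subsingleton.elim _ _) ?_
        exact (Category.comp_id _).symm.trans (CostructuredArrow.w f)
    have h1 := (p.isPointwiseLeftKanExtensionLeftKanExtensionUnit Q b).isIso_ι_app_of_isTerminal t ht
    have h2 : IsIso (η.app o) := by
      have h3 : η.app o ≫ L.map (𝟙 b) = η.app o :=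
        (congrArg (η.app o ≫ ·) (L.map_id b)).trans (Category.comp_id _)
      exact h3 ▸ h1
    have h4 : (lexYoneda C).map (η.app o) ≫ n.app b = ε.hom.app o := (hn o).trans (Category.comp_id _)
    have h5 : IsIso ((lexYoneda C).map (η.app o) ≫ n.app b) := by
      rw [h4]
      exact (ε.app o).isIso_hom
    exact IsIso.of_isIso_comp_left ((lexYoneda C).map (η.app o)) (n.app b)

end Gluing

end Exactness

namespace Exactness

/-! ### Size of categories of structures and of comma categories -/

section Smallness

/-- A structure is determined by its graph morphism, and the graph of `Z` is finite, hence small in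
every universe. -/
instance small_str (Z : Sketch.{w}) (C : Type u) [Category.{u} C] : Small.{u} (Str Z C) := by
  refine small_of_injective (β := Σ o : Z.V → C, ∀ a b : Z.V, (a ⟶ b) → (o a ⟶ o b))
    (f := fun F => ⟨F.graph.obj, fun a b f => F.graph.map f⟩) fun F G h => ?_
  obtain ⟨⟨Fo, Fm⟩, _, _, _⟩ := F
  obtain ⟨⟨Go, Gm⟩, _, _, _⟩ := G
  have ho : Fo = Go := congrArg Sigma.fst h
  subst ho
  have hm : @Fm = @Gm := eq_of_heq (Sigma.mk.inj h).2
  subst hm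
  rfl

instance small_str_hom {Z : Sketch.{w}} {D : Type u₁} [Category.{u} D] (F G : Str Z D) :
    Small.{u} (F ⟶ G) :=
  small_of_injective (β := ∀ z, F.graph.obj z ⟶ G.graph.obj z) (f := fun m => m.app)
    fun _ _ h => Str.Hom.ext h

instance small_fiber {X A : Sketch.{w}} (α : X.Hom A) {C : Type u} [Category.{u} C] (F : Str X C) :
    Small.{u} (Fib α F) :=
  inferInstanceAs (Small.{u} {a : Str A C // (restr α C).obj a = F})

instance small_fiber_hom {X A : Sketch.{w}} {α : X.Hom A} {D : Type u₁} [Category.{u} D]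
    {F : Str X D} (G H : Fib α F) : Small.{u} (G ⟶ H) :=
  inferInstanceAs (Small.{u} {φ : G.1 ⟶ H.1 // (restr α D).IsHomLift (𝟙 F) φ})

theorem essentiallySmall_costructuredArrow {K : Type u₁} [Category.{v₁} K] {G : Type u₂}
    [Category.{v₂} G] (Y : K ⥤ G) (g : G) [Small.{u} K] [∀ k l : K, Small.{u} (k ⟶ l)]
    [∀ k l : G, Small.{u} (k ⟶ l)] : EssentiallySmall.{u} (CostructuredArrow Y g) := by
  have : Small.{u} (CostructuredArrow Y g) :=
    small_of_injective (β := Σ k, Y.obj k ⟶ g) (f := fun i => ⟨i.left, i.hom⟩) fun i j h => by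
      obtain ⟨l, ⟨⟨⟩⟩, f⟩ := i
      obtain ⟨l', ⟨⟨⟩⟩, f'⟩ := j
      cases h
      rfl
  have : LocallySmall.{u} (CostructuredArrow Y g) :=
    ⟨fun i j => small_of_injective (β := i.left ⟶ j.left) (f := fun f => f.left)
      fun _ _ h => CostructuredArrow.hom_ext _ _ h⟩
  infer_instance

end Smallness

/-! ### Structures of unconditional type as functors -/

section Underlying

/-- The vertices of a graph with a category structure, as the objects of that category. -/
def CategoryOn.Carrier {V : Type w} [Quiver.{w} V] (_ : CategoryOn V) : Type w := V

instance {V : Type w} [Quiver.{w} V] (K : CategoryOn V) : Category.{w} K.Carrier where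
  Hom a b := @Quiver.Hom V _ a b
  id a := K.id a
  comp f g := K.comp f g
  id_comp f := K.id_comp f
  comp_id f := K.comp_id f
  assoc f g h := K.assoc f g h

noncomputable instance {V : Type w} [Quiver.{w} V] [Finite V] [hV : ∀ a b : V, Finite (a ⟶ b)]
    (K : CategoryOn V) : FinCategory K.Carrier where
  fintypeObj := @Fintype.ofFinite K.Carrier (inferInstanceAs (Finite V))
  fintypeHom a b := @Fintype.ofFinite (a ⟶ b) (hV a b)

/-- `A` is the underlying sketch of the category `K`, further equipped with exactly the conditions
which appear in `X`. -/
structure Sketch.Hom.IsUnconditionalOver {X A : Sketch.{w}} (α : X.Hom A) (K : CategoryOn A.V) :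
    Prop where
  comm : A.comm = {c | K.UnderlyingComm c} ∪ CommCond.map α.graph '' X.comm
  lim : A.lim = LimData.map α.graph '' X.lim
  colim : A.colim = ColimData.map α.graph '' X.colim

variable {X A : Sketch.{w}} {α : X.Hom A} {K : CategoryOn A.V} (hK : α.IsUnconditionalOver K)
  {D : Type u} [Category.{v} D]
include hK

theorem Str.map_id_of_isUnconditionalOver (G : Str A D) (a : A.V) :
    G.graph.map (K.id a) = 𝟙 (G.graph.obj a) := by
  have h := G.comm ⟨a, a, Quiver.Path.nil.cons (K.id a), Quiver.Path.nil⟩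
    (by rw [hK.comm]; exact Or.inl (.id a))
  exact (Category.id_comp _).symm.trans h

theorem Str.map_comp_of_isUnconditionalOver (G : Str A D) {a b c : A.V} (f : a ⟶ b) (g : b ⟶ c) :
    G.graph.map (K.comp f g) = G.graph.map f ≫ G.graph.map g := by
  have h := G.comm ⟨a, c, (Quiver.Path.nil.cons f).cons g, Quiver.Path.nil.cons (K.comp f g)⟩
    (by rw [hK.comm]; exact Or.inl (.comp f g))
  have h' : (𝟙 _ ≫ G.graph.map f) ≫ G.graph.map g = 𝟙 _ ≫ G.graph.map (K.comp f g) := h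
  rw [Category.id_comp, Category.id_comp] at h'
  exact h'.symm

/-- The functor underlying a structure. -/
@[simps]
def Str.toFunctor : Str A D ⥤ (K.Carrier ⥤ D) where
  obj G :=
    { obj := G.graph.obj
      map := fun {a b} f => G.graph.map (X := a) (Y := b) f
      map_id := G.map_id_of_isUnconditionalOver hK
      map_comp := G.map_comp_of_isUnconditionalOver hK }
  map m :=
    { app := m.app
      naturality := fun a b f => m.naturality a b f }

/-- A functor which restricts, up to isomorphism, to a structure of type `X`, is a structure. -/
def Str.ofFunctor (P : K.Carrier ⥤ D) (F : Str X D)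
    (e : ∀ x, F.graph.obj x ≅ P.obj (α.graph.obj x))
    (h : ∀ (x y : X.V) (f : x ⟶ y),
      F.graph.map f ≫ (e y).hom = (e x).hom ≫ P.map (α.graph.map f)) : Str A D where
  graph := { obj := P.obj, map := fun f => P.map f }
  comm c hc := by
    -- A condition of `A` either expresses composition or identities in `K`, where functoriality
    -- applies, or comes from `X`, where it is transported from `F`.
    rw [hK.comm] at hc
    obtain (hc | ⟨c, hc, rfl⟩) := hc
    · obtain (⟨f, g⟩ | a) := hc
      · exact (Category.assoc _ _ _).trans (congrArg (𝟙 _ ≫ ·) (P.map_comp f g).symm)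
      · exact (Category.id_comp _).trans (P.map_id a)
    · have h := (F.ofGraphIso (α.graph ⋙q { obj := P.obj, map := fun f => P.map f }) e h).comm c hc
      simp only [CommCond.map]
      rw [← Prefunctor.mapPath_comp_apply, ← Prefunctor.mapPath_comp_apply]
      exact h
  lim t ht := by
    rw [hK.lim] at ht
    obtain ⟨t, ht, rfl⟩ := ht
    exact (F.ofGraphIso (α.graph ⋙q { obj := P.obj, map := fun f => P.map f }) e h).lim t ht
  colim t ht := by
    rw [hK.colim] at ht
    obtain ⟨t, ht, rfl⟩ := ht
    exact (F.ofGraphIso (α.graph ⋙q { obj := P.obj, map := fun f => P.map f }) e h).colim t ht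

end Underlying

/-! ### The Yoneda embedding between fibres -/

section Fibres

variable {X A : Sketch.{w}} (α : X.Hom A) {C : Type u} [SmallCategory C] (F : Str X C)

theorem fiberInclusion_comp_strLexYoneda :
    ((Functor.Fiber.fiberInclusion : Fib α F ⥤ _) ⋙ strLexYoneda A C) ⋙ restr α _ =
      (Functor.const _).obj F.lexYoneda := by
  refine (congrArg (· ⋙ strLexYoneda X C)
    (Functor.Fiber.fiberInclusion_comp_eq_const (p := restr α C) (S := F))).trans ?_
  refine CategoryTheory.Functor.ext (fun _ => rfl) fun k l f => ?_
  exact ((strLexYoneda X C).map_id F).trans (Category.comp_id _).symm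

/-- The functor between the fibres induced by the restricted Yoneda embedding. -/
def fibLexYoneda : Fib α F ⥤ Fib α F.lexYoneda :=
  Functor.Fiber.inducedFunctor (fiberInclusion_comp_strLexYoneda α F)

variable {α F}

/-- Since `m` and `n` lie over the identity, the restriction of `f` becomes an identity, up to
`eqToHom`, after a faithful functor. -/
theorem isHomLift_of_strLexYoneda {k l : Fib α F} {G : Fib α F.lexYoneda} (f : k.1 ⟶ l.1)
    (m : (fibLexYoneda α F).obj k ⟶ G) (n : (fibLexYoneda α F).obj l ⟶ G)
    (h : (strLexYoneda A C).map f ≫ n.1 = m.1) : (restr α C).IsHomLift (𝟙 F) f := by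
  have hm := m.2
  have hn := n.2
  have hm' := IsHomLift.fac' (restr α _) (𝟙 F.lexYoneda) m.1
  have hn' := IsHomLift.fac' (restr α _) (𝟙 F.lexYoneda) n.1
  have h' : (strLexYoneda X C).map ((restr α C).map f) ≫ (restr α _).map n.1 =
      (restr α _).map m.1 := congrArg (restr α _).map h
  have hk : (restr α C).obj k.1 = F := k.2
  have hl : (restr α C).obj l.1 = F := l.2
  have hG : (restr α _).obj G.1 = F.lexYoneda := G.2
  have h2 : (strLexYoneda X C).map ((restr α C).map f) =
      eqToHom (congrArg (strLexYoneda X C).obj (hk.trans hl.symm)) := by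
    rw [hm', hn', Category.id_comp, eqToHom_trans, eqToHom_trans] at h'
    have h3 := congrArg (· ≫ eqToHom (hG.trans (congrArg (strLexYoneda X C).obj hl).symm)) h'
    exact (Category.comp_id _).symm.trans ((congrArg (_ ≫ ·) (eqToHom_trans _ _).symm).trans
      ((Category.assoc _ _ _).symm.trans (h3.trans (eqToHom_trans _ _))))
  have h4 : (restr α C).map f = eqToHom (hk.trans hl.symm) :=
    (strLexYoneda X C).map_injective (h2.trans (eqToHom_map _ _).symm)
  refine IsHomLift.of_fac' _ _ _ hk hl ?_
  rw [h4, Category.id_comp, eqToHom_trans]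

end Fibres

end Exactness

namespace Exactness

/-! ### A criterion for filtered colimits of representables -/

section RecognizeColimits

variable {C : Type u} [SmallCategory C] {J : Type u₁} [Category.{v₁} J] [IsFilteredOrEmpty J]

/-- Recognizing filtered colimits of representable functors. -/
noncomputable def isColimitOfExistsHom {N : J ⥤ C} (s : Cocone (N ⋙ lexYoneda C))
    (hsurj : ∀ (c : C) (x : (lexYoneda C).obj c ⟶ s.pt),
      ∃ (j : J) (f : c ⟶ N.obj j), (lexYoneda C).map f ≫ s.ι.app j = x)
    (hinj : ∀ (c : C) (j : J) (f g : c ⟶ N.obj j),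
      (lexYoneda C).map f ≫ s.ι.app j = (lexYoneda C).map g ≫ s.ι.app j →
        ∃ (k : J) (u : j ⟶ k), f ≫ N.map u = g ≫ N.map u) : IsColimit s := by
  have key : ∀ (c : C) (j : J) (f : c ⟶ N.obj j),
      lexElem ((lexYoneda C).map f ≫ s.ι.app j) (𝟙 c) = lexElem (s.ι.app j) f := fun c j f =>
    (lexElem_map_comp _ _ _).trans (congrArg _ (Category.id_comp f))
  -- It suffices to have a colimit of sets at each object; by Yoneda, elements there are maps out of
  -- representables.
  refine isColimitOfReflects (ObjectProperty.ι _) (evaluationJointlyReflectsColimits _ fun c =>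
    Types.FilteredColimit.isColimitOf' _ _ (fun p => ?_) fun j f g h => ?_)
  · obtain ⟨j, f, hf⟩ := hsurj c.unop ⟨yonedaEquiv.symm p⟩
    refine ⟨j, f, ?_⟩
    have h1 : yonedaEquiv (yonedaEquiv.symm p) = lexElem (s.ι.app j) f :=
      (congrArg (fun m => lexElem m (𝟙 c.unop)) hf).symm.trans (key _ j f)
    rw [Equiv.apply_symm_apply] at h1
    exact h1
  · have h' : lexElem (s.ι.app j) f = lexElem (s.ι.app j) g := h
    obtain ⟨k, u, hu⟩ := hinj c.unop j f g
      (lexElem_injective ((key _ j f).trans (h'.trans (key _ j g).symm)))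
    exact ⟨k, u, hu⟩

end RecognizeColimits

theorem isHomLift_id_of_map_eq {E : Type*} {B : Type*} [Category* E] [Category* B] {p : E ⥤ B}
    {b : B} {x y : E} (hx : p.obj x = b) (hy : p.obj y = b) {f : x ⟶ y}
    (h : p.map f = eqToHom (hx.trans hy.symm)) : p.IsHomLift (𝟙 b) f :=
  IsHomLift.of_fac' _ _ _ hx hy (by rw [h, Category.id_comp, eqToHom_trans])

theorem whiskerRight_comp_comp_of_comp_eq_id {B D E : Type*} [Category* B] [Category* D]
    [Category* E] (y : D ⥤ E) {L L' L'' : B ⥤ D} (k : L ⟶ L') {p : L' ⟶ L''} {q : L'' ⟶ L'}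
    (h : p ≫ q = 𝟙 L') {T : B ⥤ E} (n : L' ⋙ y ⟶ T) :
    Functor.whiskerRight (k ≫ p) y ≫ Functor.whiskerRight q y ≫ n =
      Functor.whiskerRight k y ≫ n := by
  rw [← Category.assoc, ← Functor.whiskerRight_comp, Category.assoc, h, Category.comp_id]

/-- The isomorphism `γ` followed by the inverse of `n` lies between representables, so it descends
to `C` by full faithfulness. -/
theorem exists_iso_of_isIso_app {X : Sketch.{w}} {C : Type u} [SmallCategory C] (F : Str X C)
    (Q : X.V ⥤q C) {P : Str X (Cᵒᵖ ⥤ₗ Type u)} (γ : F.lexYoneda ≅ P)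
    (n : ∀ x, (lexYoneda C).obj (Q.obj x) ⟶ P.graph.obj x) (hi : ∀ x, IsIso (n x))
    (hn : ∀ (x y : X.V) (f : x ⟶ y),
      (lexYoneda C).map (Q.map f) ≫ n y = n x ≫ P.graph.map f) :
    ∃ e : ∀ x, F.graph.obj x ≅ Q.obj x,
      (∀ (x y : X.V) (f : x ⟶ y), F.graph.map f ≫ (e y).hom = (e x).hom ≫ Q.map f) ∧
        ∀ x, (lexYoneda C).map (e x).hom ≫ n x = γ.hom.app x := by
  let E : ∀ x, (lexYoneda C).obj (F.graph.obj x) ≅ (lexYoneda C).obj (Q.obj x) := fun x =>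
    Str.isoApp γ x ≪≫ (asIso (n x)).symm
  have hE : ∀ x, (E x).hom ≫ n x = γ.hom.app x := fun x =>
    (Category.assoc _ _ _).trans
      ((congrArg (_ ≫ ·) (asIso (n x)).inv_hom_id).trans (Category.comp_id _))
  have he : ∀ x, (lexYoneda C).map ((lexYoneda C).preimageIso (E x)).hom = (E x).hom := fun x =>
    (lexYoneda C).map_preimage _
  refine ⟨fun x => (lexYoneda C).preimageIso (E x), fun x y f => ?_, fun x => ?_⟩
  · apply (lexYoneda C).map_injective
    have h1 : (lexYoneda C).map (F.graph.map f) ≫ γ.hom.app y =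
        γ.hom.app x ≫ P.graph.map f := γ.hom.naturality x y f
    rw [Functor.map_comp, Functor.map_comp, he, he, ← cancel_mono (n y), Category.assoc,
      Category.assoc, hE, hn, ← Category.assoc, hE, h1]
    rfl
  · exact (congrArg (· ≫ n x) (he x)).trans (hE x)

/-! ### Density of the fibre over `F` in the fibre over `F.lexYoneda` -/

section Comparison

variable {X A : Sketch.{w}} {α : X.Hom A} {K : CategoryOn A.V} (hK : α.IsUnconditionalOver K)
  {C : Type u} [SmallCategory C] {F : Str X C}

/-- The diagrams over a structure in a fibre. -/
abbrev DiagramsOver (G : Fib α F.lexYoneda) :=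
  CostructuredArrow ((Functor.whiskeringRight K.Carrier C _).obj (lexYoneda C))
    ((Str.toFunctor hK).obj G.1)

/-- The functor which forgets that a diagram is a structure. -/
@[simps]
def toDiagramsOver (G : Fib α F.lexYoneda) :
    CostructuredArrow (fibLexYoneda α F) G ⥤ DiagramsOver hK G where
  obj i := CostructuredArrow.mk (Y := (Str.toFunctor hK).obj i.left.1)
    ((Str.toFunctor hK).map i.hom.1)
  map f := CostructuredArrow.homMk ((Str.toFunctor hK).map f.left.1)
    (congrArg (fun m : (fibLexYoneda α F).obj _ ⟶ G => (Str.toFunctor hK).map m.1)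
      (CostructuredArrow.w f))
  map_id _ := rfl
  map_comp _ _ := rfl

instance (G : Fib α F.lexYoneda) : (toDiagramsOver hK G).Faithful where
  map_injective {i j f g} h := by
    refine CostructuredArrow.hom_ext _ _ (Subtype.ext (Str.hom_ext fun a => ?_))
    exact congrArg (fun m => m.left.app a) h

instance (G : Fib α F.lexYoneda) : (toDiagramsOver hK G).Full where
  map_surjective {i j} f := by
    let f' : i.left.1 ⟶ j.left.1 := ⟨f.left.app, fun a b g => f.left.naturality g⟩
    have h : (strLexYoneda A C).map f' ≫ j.hom.1 = i.hom.1 :=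
      Str.hom_ext fun a => NatTrans.congr_app (CostructuredArrow.w f) a
    refine ⟨CostructuredArrow.homMk ⟨f', isHomLift_of_strLexYoneda f' i.hom j.hom h⟩
      (Subtype.ext h), ?_⟩
    rfl

variable [HasFiniteColimits C]

/-- At the vertices of `X` the structure `T` is representable, so `L` can be enlarged to a diagram
isomorphic to `F` there. By unconditionality that diagram is a structure, and the isofibration
property puts it strictly in the fibre. -/
theorem exists_structure_of_diagram (hα : Function.Injective α.graph.obj)
    (T : Str A (Cᵒᵖ ⥤ₗ Type u)) (hT : (restr α _).obj T = F.lexYoneda)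
    (L : K.Carrier ⥤ C) (m : L ⋙ lexYoneda C ⟶ (Str.toFunctor hK).obj T) :
    ∃ (H : Str A C) (hH : (restr α C).obj H = F) (k : L ⟶ (Str.toFunctor hK).obj H)
      (n : (strLexYoneda A C).obj H ⟶ T),
      Functor.whiskerRight k (lexYoneda C) ≫ (Str.toFunctor hK).map n = m ∧
        (restr α _).map n = eqToHom ((congrArg (strLexYoneda X C).obj hH).trans hT.symm) := by
  let γ : F.lexYoneda ≅ (restr α _).obj T := eqToIso hT.symm
  obtain ⟨L', k, n, hkn, hn⟩ := exists_hom_of_mem_essImage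
    (fun a : K.Carrier => ∃ x : X.V, α.graph.obj x = a) L _ m
    (by
      rintro _ ⟨x, rfl⟩
      exact ⟨F.graph.obj x, ⟨Str.isoApp γ x⟩⟩)
  let n₀ : ∀ a : A.V, (lexYoneda C).obj (L'.obj a) ⟶ T.graph.obj a := n.app
  have hn₀ : ∀ x : X.V, IsIso (n₀ (α.graph.obj x)) := fun x => hn _ ⟨x, rfl⟩
  let Q : X.V ⥤q C :=
    { obj := fun x => L'.obj (α.graph.obj x)
      map := fun f => L'.map (X := (α.graph.obj _ : A.V)) (Y := (α.graph.obj _ : A.V))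
        (α.graph.map f) }
  obtain ⟨e, he, hen⟩ := exists_iso_of_isIso_app F Q γ (fun x => n₀ (α.graph.obj x)) hn₀
    fun x y f => n.naturality (X := (α.graph.obj x : A.V)) (Y := (α.graph.obj y : A.V))
      (α.graph.map f)
  let H₀ : Str A C := Str.ofFunctor hK L' F e he
  let ε : (restr α C).obj H₀ ≅ F := (Str.isoMk e he : F ≅ (restr α C).obj H₀).symm
  obtain ⟨H, hH, e', he'⟩ := isIsofibration_restr α hα H₀ F ε
  let n₁ : (strLexYoneda A C).obj H₀ ⟶ T := ⟨n₀, fun a b f => n.naturality f⟩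
  have hε : (strLexYoneda X C).map ε.inv ≫ (restr α _).map n₁ = γ.hom := Str.hom_ext hen
  have he'' : (restr α C).map e'.inv = eqToHom hH ≫ ε.inv := by
    rw [← cancel_epi ((restr α C).map e'.hom), ← (restr α C).map_comp, Iso.hom_inv_id, he',
      (restr α C).map_id, Category.assoc, eqToHom_trans_assoc, eqToHom_refl, Category.id_comp,
      Iso.hom_inv_id]
  let ψ : L' ⟶ (Str.toFunctor hK).obj H := (Str.toFunctor hK).map e'.hom
  let ψ' : (Str.toFunctor hK).obj H ⟶ L' := (Str.toFunctor hK).map e'.inv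
  have hψ : ψ ≫ ψ' = 𝟙 L' := ((Str.toFunctor hK).map_comp _ _).symm.trans
    ((congrArg _ e'.hom_inv_id).trans ((Str.toFunctor hK).map_id H₀))
  refine ⟨H, hH, k ≫ ψ, (strLexYoneda A C).map e'.inv ≫ n₁,
    (whiskerRight_comp_comp_of_comp_eq_id (lexYoneda C) k hψ n).trans hkn, ?_⟩
  have h1 : (restr α _).map ((strLexYoneda A C).map e'.inv ≫ n₁) =
      (strLexYoneda X C).map ((restr α C).map e'.inv) ≫ (restr α _).map n₁ := rfl
  have h2 : (strLexYoneda X C).map (eqToHom hH) ≫ γ.hom =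
      eqToHom ((congrArg (strLexYoneda X C).obj hH).trans hT.symm) :=
    (congrArg (· ≫ γ.hom) (eqToHom_map _ hH)).trans (eqToHom_trans _ hT.symm)
  rw [h1, he'', (strLexYoneda X C).map_comp]
  exact (Category.assoc _ _ _).trans ((congrArg (_ ≫ ·) hε).trans h2)

theorem exists_fibre_of_diagram (hα : Function.Injective α.graph.obj) (G : Fib α F.lexYoneda)
    (L : K.Carrier ⥤ C) (m : L ⋙ lexYoneda C ⟶ (Str.toFunctor hK).obj G.1) :
    ∃ (H : Fib α F) (k : L ⟶ (Str.toFunctor hK).obj H.1) (n : (fibLexYoneda α F).obj H ⟶ G),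
      Functor.whiskerRight k (lexYoneda C) ≫ (Str.toFunctor hK).map n.1 = m := by
  obtain ⟨H, hH, k, n, hkn, hn⟩ := exists_structure_of_diagram hK hα G.1 G.2 L m
  have hH' : (restr α _).obj ((strLexYoneda A C).obj H) = F.lexYoneda :=
    congrArg (strLexYoneda X C).obj hH
  exact ⟨⟨H, hH⟩, k, ⟨n, isHomLift_id_of_map_eq hH' G.2 hn⟩, hkn⟩

include hK

theorem exists_hom_toDiagramsOver (hα : Function.Injective α.graph.obj) (G : Fib α F.lexYoneda)
    (d : DiagramsOver hK G) : ∃ i, Nonempty (d ⟶ (toDiagramsOver hK G).obj i) := by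
  obtain ⟨H, k, n, h⟩ := exists_fibre_of_diagram hK hα G d.left d.hom
  exact ⟨CostructuredArrow.mk n, ⟨CostructuredArrow.homMk k h⟩⟩

/-- Filteredness passes to a full subcategory into which every object of the ambient filtered
category maps. -/
theorem isFiltered_costructuredArrow_fibLexYoneda (hα : Function.Injective α.graph.obj)
    (G : Fib α F.lexYoneda) : IsFiltered (CostructuredArrow (fibLexYoneda α F) G) :=
  IsFiltered.of_exists_of_isFiltered_of_fullyFaithful (toDiagramsOver hK G)
    (exists_hom_toDiagramsOver hK hα G)

omit hK [HasFiniteColimits C] in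
theorem essentiallySmall_costructuredArrow_fibLexYoneda (G : Fib α F.lexYoneda) :
    EssentiallySmall.{u} (CostructuredArrow (fibLexYoneda α F) G) :=
  essentiallySmall_costructuredArrow _ _

/-- The canonical transformation which exhibits the density of the Yoneda embedding of fibres. -/
def fibLexYonedaTransformation (α : X.Hom A) (F : Str X C) :
    (Functor.Fiber.fiberInclusion : Fib α F ⥤ _) ⋙ strLexYoneda A C ⟶
      fibLexYoneda α F ⋙ Functor.Fiber.fiberInclusion where
  app k := 𝟙 ((strLexYoneda A C).obj k.1)
  naturality _ _ _ := (Category.comp_id _).trans (Category.id_comp _).symm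

/-- Structures in the fibre over a structure of representable functors are, at each vertex,
colimits of representable structures. -/
noncomputable def isPointwiseLeftKanExtension_fibLexYoneda (hα : Function.Injective α.graph.obj)
    (a : A.V) :
    (Functor.LeftExtension.mk (Functor.Fiber.fiberInclusion ⋙ Str.ev A _ a)
      (vertexTransformation (fibLexYonedaTransformation α F)
        a)).IsPointwiseLeftKanExtension := fun G => by
  have := isFiltered_costructuredArrow_fibLexYoneda hK hα G
  have hι : ∀ (i : CostructuredArrow (fibLexYoneda α F) G) (c : C)
      (f : c ⟶ i.left.1.graph.obj a), (lexYoneda C).map f ≫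
        𝟙 ((lexYoneda C).obj (i.left.1.graph.obj a)) ≫ i.hom.1.app a =
          (lexYoneda C).map f ≫ i.hom.1.app a := fun i c f => congrArg (_ ≫ ·) (Category.id_comp _)
  refine isColimitOfExistsHom
    (N := CostructuredArrow.proj (fibLexYoneda α F) G ⋙ Functor.Fiber.fiberInclusion ⋙
      Str.ev A C a) _ (fun c x => ?_) fun c i f g hfg => ?_
  · obtain ⟨L, η, -, hL⟩ := exists_free_diagram (B := K.Carrier) a c
    obtain ⟨m, hm, -⟩ := hL ((Str.toFunctor hK).obj G.1) x
    -- The element `x`, extended freely to a diagram over `G`, factors through a structure in the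
    -- fibre.
    obtain ⟨H, k, n, h⟩ := exists_fibre_of_diagram hK hα G L m
    refine ⟨CostructuredArrow.mk n, η ≫ k.app a, (hι (CostructuredArrow.mk n) c _).trans ?_⟩
    have h1 : (lexYoneda C).map (k.app a) ≫ n.1.app a = m.app a := NatTrans.congr_app h a
    have h2 : (lexYoneda C).map (η ≫ k.app a) ≫ n.1.app a = (lexYoneda C).map η ≫ m.app a :=
      ((lexYoneda C).map_comp_assoc _ _ _).trans (congrArg (_ ≫ ·) h1)
    exact h2.trans hm
  · have hfg' : (lexYoneda C).map f ≫ i.hom.1.app a = (lexYoneda C).map g ≫ i.hom.1.app a :=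
      (hι i c f).symm.trans (hfg.trans (hι i c g))
    obtain ⟨L, η, hL', hL⟩ := exists_free_diagram (B := K.Carrier) a c
    obtain ⟨l, hl⟩ := hL' ((Str.toFunctor hK).obj i.left.1) f
    obtain ⟨l', hl'⟩ := hL' ((Str.toFunctor hK).obj i.left.1) g
    have key : ∀ (l : L ⟶ (Str.toFunctor hK).obj i.left.1) (f : c ⟶ i.left.1.graph.obj a),
        η ≫ l.app a = f → (lexYoneda C).map η ≫ (lexYoneda C).map (l.app a) ≫ i.hom.1.app a =
          (lexYoneda C).map f ≫ i.hom.1.app a := by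
      rintro l _ rfl
      exact ((lexYoneda C).map_comp_assoc _ _ _).symm
    -- Freeness upgrades the equality of two elements of `G` at `a` to an equality of two maps of
    -- diagrams into `G`.
    have hll : Functor.whiskerRight l (lexYoneda C) ≫ (Str.toFunctor hK).map i.hom.1 =
        Functor.whiskerRight l' (lexYoneda C) ≫ (Str.toFunctor hK).map i.hom.1 :=
      (hL ((Str.toFunctor hK).obj G.1) ((lexYoneda C).map f ≫ i.hom.1.app a)).unique
        (key l f hl) ((key l' g hl').trans hfg'.symm)
    let d : DiagramsOver hK G := CostructuredArrow.mk (Y := L)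
      (Functor.whiskerRight l (lexYoneda C) ≫ (Str.toFunctor hK).map i.hom.1)
    let p : d ⟶ (toDiagramsOver hK G).obj i := CostructuredArrow.homMk l rfl
    let p' : d ⟶ (toDiagramsOver hK G).obj i := CostructuredArrow.homMk l' hll.symm
    -- Coequalize `p` and `p'` among all diagrams over `G`, then move on into the fibre; fullness
    -- makes the composite a transition map `r`.
    obtain ⟨j, ⟨q⟩⟩ := exists_hom_toDiagramsOver hK hα G (IsFiltered.coeq p p')
    obtain ⟨r, hr⟩ := (toDiagramsOver hK G).map_surjective (IsFiltered.coeqHom p p' ≫ q)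
    have hpr : p ≫ (toDiagramsOver hK G).map r = p' ≫ (toDiagramsOver hK G).map r := by
      rw [hr, IsFiltered.coeq_condition_assoc]
    have hpr' : l.app a ≫ r.left.1.app a = l'.app a ≫ r.left.1.app a :=
      congrArg (fun m => m.left.app a) hpr
    refine ⟨j, r, ?_⟩
    have h1 : f ≫ r.left.1.app a = g ≫ r.left.1.app a := by
      rw [← hl, ← hl']
      exact (Category.assoc _ _ _).trans ((congrArg (η ≫ ·) hpr').trans
        (Category.assoc _ _ _).symm)
    exact h1

end Comparison

end Exactness

namespace Exactness

/-! ### Extending the verification -/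

/-- A functor to structures which extends the inclusion of a fibre is a functorial verification. -/
theorem Sequent.HasFunctorialVerification.of_functor {X : Sketch.{w}} (S : Sequent X) {D : Type u}
    [Category.{v} D] (F : Str X D) (R : Fib S.α F ⥤ Str S.B D)
    (hR : R ⋙ restr S.β D = Functor.Fiber.fiberInclusion) : S.HasFunctorialVerification F := by
  have h : R ⋙ restr (S.α.comp S.β) D = (Functor.const _).obj F :=
    (congrArg (· ⋙ restr S.α D) hR).trans Functor.Fiber.fiberInclusion_comp_eq_const
  let R' : Fib S.α F ⥤ Fib (S.α.comp S.β) F := Functor.Fiber.inducedFunctor h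
  have hR' : (R' ⋙ S.fibRestr F) ⋙ Functor.Fiber.fiberInclusion =
      Functor.Fiber.fiberInclusion := hR
  refine ⟨R', CategoryTheory.Functor.ext
    (fun k => Functor.Fiber.fiberInclusion_obj_inj (Functor.congr_obj hR' k)) fun k l f => ?_⟩
  apply Functor.Fiber.hom_ext
  rw [Functor.map_comp, Functor.map_comp, eqToHom_map, eqToHom_map]
  exact Functor.congr_hom hR' f

end Exactness

theorem theorem2p4 (X : Exactness.Sketch.{w}) (S : Exactness.Sequent X)
    (hα : S.α.IsUnconditionalOfFiniteKind)
    (C : Type u) [SmallCategory C] [HasFiniteColimits C] (F : Exactness.Str X C)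
    (hF : S.HasFunctorialVerification F) :
    S.HasFunctorialVerification F.lexYoneda := by
  obtain ⟨hi, K, hcomm, hlim, hcolim⟩ := hα
  obtain ⟨R, hR⟩ := hF
  have hK : S.α.IsUnconditionalOver K := ⟨hcomm, hlim, hcolim⟩
  have (G : Exactness.Fib S.α F.lexYoneda) :=
    Exactness.isFiltered_costructuredArrow_fibLexYoneda hK hi.obj_injective G
  have (G : Exactness.Fib S.α F.lexYoneda) :=
    Exactness.essentiallySmall_costructuredArrow_fibLexYoneda G
  let U : Exactness.Fib S.α F ⥤ Exactness.Str S.B C := R ⋙ Functor.Fiber.fiberInclusion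
  have hU : U ⋙ Exactness.restr S.β C = Functor.Fiber.fiberInclusion :=
    congrArg (· ⋙ Functor.Fiber.fiberInclusion) hR
  let e : Exactness.lanStr (Exactness.fibLexYoneda S.α F) (U ⋙ Exactness.restr S.β C) ≅
      Functor.Fiber.fiberInclusion :=
    eqToIso (congrArg _ hU) ≪≫
      Exactness.lanStrIso (Exactness.fibLexYonedaTransformation S.α F) fun a =>
        Exactness.isPointwiseLeftKanExtension_fibLexYoneda hK hi.obj_injective a
  -- The Kan extension is formed vertexwise, so extending `U` and then restricting along `S.β` is by
  -- definition the extension of the restriction of `U`, to which `e` applies.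
  obtain ⟨R', hR'⟩ :=
    (Exactness.isIsofibration_restr S.β S.β_incl.obj_injective).exists_functor
      (Exactness.lanStr (Exactness.fibLexYoneda S.α F) U) Functor.Fiber.fiberInclusion e
  exact .of_functor S _ R' hR'
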